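/- Let $\mathcal H$ be a complex separable Hilbert space and let $A$, $B$, $C$ be (possibly unbounded) linear operators in $\mathcal H$. For a self-adjoint operator $T$ put $\kappa_-(T)=\dim\operatorname{ran}\chi_{(-\infty,0)}(T)$, where $\chi_{(-\infty,0)}(T)$ is the spectral projection of $T$ for $(-\infty,0)$. For an operator $T$, let $\rho(T)$ be the set of $z\in\mathbb C$ such that $T-z$ maps $\operatorname{dom}(T)$ bijectively onto the whole space with bounded inverse. Assume: (i) $A=A^*$, $0\in\rho(A)$ and $\kappa_-(A)<\infty$; (ii) $C$ is closed, $\operatorname{dom}(A)\subset\operatorname{dom}(C)$ and $\operatorname{dom}(A)\subset\operatorname{dom}(C^*)$; (iii) $B=B^*$; (iv) $\operatorname{dom}(S_0):=\operatorname{dom}(C^*)\cap\operatorname{dom}(B)$ is dense in $\mathcal H$, and the operator $S_0:=B-CA^{-1}C^*$ is essentially self-adjoint on $\operatorname{dom}(S_0)$ with $\kappa_-(\overline{S_0})<\infty$. In $\mathcal H\times\mathcal H$ consider $$\mathcal J=\begin{pmatrix}0&\mathrm i I\\-\mathrm i I&0\end{pmatrix},\qquad \mathcal A_0=\begin{pmatrix}A&C^*\\C&B\end{pmatrix},\qquad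 \operatorname{dom}(\mathcal A_0)=\operatorname{dom}(A)\times\operatorname{dom}(S_0),$$ and let $\mathcal L$ be the closure of $\mathcal L_0=\mathcal J\mathcal A_0$. For $z\in\mathbb C$ let $$T(z)=B-(C+\mathrm i z)A^{-1}(C^*-\mathrm i z),\qquad \operatorname{dom}(T(z))=\operatorname{dom}(C^*)\cap\operatorname{dom}(B),$$ and let $\overline{T(z)}$ be its closure. An operator $L$ in $\mathcal H\times\mathcal H$ is called definitizable if it is $\mathcal J$-self-adjoint (that is, $\mathcal JL$ is self-adjoint), $\rho(L)\neq\emptyset$, and there is a real polynomial $p\ne0$ such that $\langle\mathcal J p(L)f,f\rangle\ge0$ for all $f\in\operatorname{dom}(p(L))$. Then $\mathcal L$ is definitizable if and only if there is $z\in\mathbb C$ such that $0\in\rho(\overline{T(z)})$. -/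

import Mathlib

open scoped LinearPMap ComplexOrder

noncomputable section

namespace BlockOp

section General

variable {K : Type*} [NormedAddCommGroup K] [InnerProductSpace ℂ K]

/-- The operator `T + w I` on the domain of `T`. -/
def addScalar (T : K →ₗ.[ℂ] K) (w : ℂ) : K →ₗ.[ℂ] K :=
  (w • (LinearMap.id : K →ₗ[ℂ] K)) +ᵥ T

/-- The product `S T` of two unbounded operators on its maximal domain
`{f ∈ dom T | T f ∈ dom S}`. -/
def mulMax (S T : K →ₗ.[ℂ] K) : K →ₗ.[ℂ] K where
  domain := (S.domain.comap T.toFun).map T.domain.subtype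
  toFun :=
    { toFun := fun f => S ⟨T ⟨f, by
          obtain ⟨_, ⟨g, _, hg⟩⟩ := f
          exact hg ▸ g.2⟩, by
          obtain ⟨_, ⟨g, hg', rfl⟩⟩ := f
          exact hg'⟩
      map_add' := fun f g => by
        rw [← S.map_add]
        congr 1
        ext
        exact T.map_add ⟨f, _⟩ ⟨g, _⟩
      map_smul' := fun c f => by
        rw [RingHom.id_apply, ← S.map_smul]
        congr 1
        ext
        exact T.map_smul c ⟨f, _⟩ }

/-- The powers `T ^ n` of an unbounded operator, each on its maximal domain. -/
def powMax (T : K →ₗ.[ℂ] K) : ℕ → (K →ₗ.[ℂ] K)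
  | 0 => (LinearMap.id : K →ₗ[ℂ] K).toPMap ⊤
  | n + 1 => mulMax T (powMax T n)

/-- For a real polynomial `p = ∑ aₖ Xᵏ` of degree `n`, the operator `p(T) = ∑ aₖ Tᵏ` on
`dom (Tⁿ)` (the domain of a sum is the intersection of the domains). -/
def polyOp (p : Polynomial ℝ) (T : K →ₗ.[ℂ] K) : K →ₗ.[ℂ] K :=
  ∑ k ∈ Finset.range (p.natDegree + 1), ((p.coeff k : ℝ) : ℂ) • powMax T k

/-- `R` is the bounded, everywhere defined, two-sided inverse of `T - z : dom T → K`. -/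
def IsResolventAt (T : K →ₗ.[ℂ] K) (z : ℂ) (R : K →L[ℂ] K) : Prop :=
  (∀ f : T.domain, R (T f - z • (f : K)) = f) ∧
    ∀ g : K, ∃ h : R g ∈ T.domain, T ⟨R g, h⟩ - z • R g = g

/-- The resolvent set `ρ(T)` of an unbounded operator. -/
def rho (T : K →ₗ.[ℂ] K) : Set ℂ := {z | ∃ R : K →L[ℂ] K, IsResolventAt T z R}

open scoped Classical in
/-- The resolvent `(T - z)⁻¹` for `z ∈ ρ(T)` (and `0` for other `z`). -/
def resolventOp (T : K →ₗ.[ℂ] K) (z : ℂ) : K →L[ℂ] K :=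
  if h : ∃ R : K →L[ℂ] K, IsResolventAt T z R then h.choose else 0

/-- The Cayley transform `(T - i)(T + i)⁻¹ = 1 - 2i (T + i)⁻¹`, a unitary operator when `T` is
self-adjoint. -/
def cayley (T : K →ₗ.[ℂ] K) : K →L[ℂ] K :=
  1 - (2 * Complex.I) • resolventOp T (-Complex.I)

variable [CompleteSpace K]

/-- `T` is essentially self-adjoint: it is closable with self-adjoint closure. -/
def IsEssentiallySelfAdjoint (T : K →ₗ.[ℂ] K) : Prop :=
  T.IsClosable ∧ IsSelfAdjoint T.closure

/-- The operator `φ(T)` for a self-adjoint operator `T` and a continuous compactly supported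
`φ : ℝ → ℝ`: the continuous functional calculus of the unitary operator `U = (T - i)(T + i)⁻¹`
applied to `φ ∘ c⁻¹`. Here `c(x) = (x - i)/(x + i)` maps `ℝ` onto the unit circle without the
point `1`, `c⁻¹(w) = i(1 + w)/(1 - w)`, and the point `1` corresponds to infinity, where `φ`
vanishes. -/
def funCalc (T : K →ₗ.[ℂ] K) (φ : ℝ → ℝ) : K →L[ℂ] K :=
  open scoped Classical in
  cfc (fun w : ℂ => if w = 1 then (0 : ℂ)
    else ((φ (Complex.I * (1 + w) / (1 - w)).re : ℝ) : ℂ)) (cayley T)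

/-- The range of the spectral projection `χ_O(T)` of a self-adjoint operator `T`, for an open set
`O ⊆ ℝ`. As `χ_O` is the supremum of an increasing sequence of nonnegative continuous functions
with compact support in `O`, it is the closure of the span of the ranges of the operators `φ(T)`,
where `φ` is continuous with compact support contained in `O`. -/
def ranSpectralProj (T : K →ₗ.[ℂ] K) (O : Set ℝ) : Submodule ℂ K :=
  (⨆ φ ∈ {φ : ℝ → ℝ | Continuous φ ∧ HasCompactSupport φ ∧ tsupport φ ⊆ O},
    LinearMap.range (funCalc T φ).toLinearMap).topologicalClosure

/-- `κ₋(T) = dim ran χ_{(-∞,0)}(T)` for a self-adjoint operator `T`. -/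
def kappaMinus (T : K →ₗ.[ℂ] K) : Cardinal :=
  Module.rank ℂ (ranSpectralProj T (Set.Iio 0))

/-- `L` is `J`-self-adjoint: `J L` is self-adjoint. For a fundamental symmetry `J` this says that
`L` is self-adjoint with respect to the indefinite inner product `[f, g] = ⟨J f, g⟩`. -/
def IsJSelfAdjoint (J : K →L[ℂ] K) (L : K →ₗ.[ℂ] K) : Prop :=
  IsSelfAdjoint (J.toLinearMap.compPMap L)

/-- Definitizable operators in the Krein space `(K, [·,·])`, `[f, g] = ⟨J f, g⟩`: the operator `L`
is `J`-self-adjoint, `ρ(L) ≠ ∅`, and there is a real polynomial `p ≠ 0` with `[p(L) f, f] ≥ 0` for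
all `f ∈ dom p(L)`. -/
def IsDefinitizable (J : K →L[ℂ] K) (L : K →ₗ.[ℂ] K) : Prop :=
  IsJSelfAdjoint J L ∧ (rho L).Nonempty ∧
    ∃ p : Polynomial ℝ, p ≠ 0 ∧
      ∀ f : (polyOp p L).domain, 0 ≤ inner ℂ (J (polyOp p L f)) (f : K)

end General

section Block

variable {H : Type*} [NormedAddCommGroup H] [InnerProductSpace ℂ H]

/-- The block operator matrix `[[P, Q], [R, S]]` in the Hilbert space `H × H` on its natural domain
`(dom P ∩ dom R) × (dom Q ∩ dom S)`. -/
def blockMatrix (P Q R S : H →ₗ.[ℂ] H) : WithLp 2 (H × H) →ₗ.[ℂ] WithLp 2 (H × H) where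
  domain := ((P.domain ⊓ R.domain).prod (Q.domain ⊓ S.domain)).comap
    (WithLp.linearEquiv 2 ℂ (H × H)).toLinearMap
  toFun :=
    { toFun := fun f => WithLp.toLp 2
        (P ⟨(f : WithLp 2 (H × H)).fst, f.2.1.1⟩ + Q ⟨(f : WithLp 2 (H × H)).snd, f.2.2.1⟩,
          R ⟨(f : WithLp 2 (H × H)).fst, f.2.1.2⟩ + S ⟨(f : WithLp 2 (H × H)).snd, f.2.2.2⟩)
      map_add' := fun f g => by
        have hP := P.map_add ⟨_, f.2.1.1⟩ ⟨_, g.2.1.1⟩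
        have hQ := Q.map_add ⟨_, f.2.2.1⟩ ⟨_, g.2.2.1⟩
        have hR := R.map_add ⟨_, f.2.1.2⟩ ⟨_, g.2.1.2⟩
        have hS := S.map_add ⟨_, f.2.2.2⟩ ⟨_, g.2.2.2⟩
        refine (WithLp.toLp_injective 2).eq_iff.2 (Prod.ext ?_ ?_)
        · exact (congrArg₂ (· + ·) hP hQ).trans (add_add_add_comm _ _ _ _)
        · exact (congrArg₂ (· + ·) hR hS).trans (add_add_add_comm _ _ _ _)
      map_smul' := fun c f => by
        have hP := P.map_smul c ⟨_, f.2.1.1⟩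
        have hQ := Q.map_smul c ⟨_, f.2.2.1⟩
        have hR := R.map_smul c ⟨_, f.2.1.2⟩
        have hS := S.map_smul c ⟨_, f.2.2.2⟩
        refine (WithLp.toLp_injective 2).eq_iff.2 (Prod.ext ?_ ?_)
        · exact (congrArg₂ (· + ·) hP hQ).trans (smul_add c _ _).symm
        · exact (congrArg₂ (· + ·) hR hS).trans (smul_add c _ _).symm }

variable (H) in
/-- The fundamental symmetry `J = [[0, i I], [-i I, 0]]` on `H × H`. -/
def J : WithLp 2 (H × H) →L[ℂ] WithLp 2 (H × H) :=
  (WithLp.prodContinuousLinearEquiv 2 ℂ H H).symm.toContinuousLinearMap ∘L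
    ((Complex.I • ContinuousLinearMap.snd ℂ H H).prod
      (-Complex.I • ContinuousLinearMap.fst ℂ H H)) ∘L
    (WithLp.prodContinuousLinearEquiv 2 ℂ H H).toContinuousLinearMap

variable [CompleteSpace H]

/-- `T(z) = B - (C + iz) A⁻¹ (C* - iz)`; its domain is `dom B ∩ dom C*` when `A⁻¹` is everywhere
defined and `dom A ⊆ dom C`. -/
def T (A B C : H →ₗ.[ℂ] H) (z : ℂ) : H →ₗ.[ℂ] H :=
  B - mulMax (addScalar C (Complex.I * z)) (mulMax A.inverse (addScalar C† (-(Complex.I * z))))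

/-- `S₀ = B - C A⁻¹ C*`; its domain is `dom B ∩ dom C*` when `A⁻¹` is everywhere defined and
`dom A ⊆ dom C`. -/
def S0 (A B C : H →ₗ.[ℂ] H) : H →ₗ.[ℂ] H :=
  B - mulMax C (mulMax A.inverse C†)

/-- The operator matrix `𝓐₀ = [[A, C*], [C, B]]`; its domain is `dom A × (dom C* ∩ dom B)` when
`dom A ⊆ dom C`. -/
def A0 (A B C : H →ₗ.[ℂ] H) : WithLp 2 (H × H) →ₗ.[ℂ] WithLp 2 (H × H) :=
  blockMatrix A C† C B

/-- `𝓛₀ = 𝓙 𝓐₀ = [[iC, iB], [-iA, -iC*]]` on the domain of `𝓐₀`. -/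
def L0 (A B C : H →ₗ.[ℂ] H) : WithLp 2 (H × H) →ₗ.[ℂ] WithLp 2 (H × H) :=
  (J H).toLinearMap.compPMap (A0 A B C)

/-- The operator `𝓛`, the closure of `𝓛₀`. -/
def L (A B C : H →ₗ.[ℂ] H) : WithLp 2 (H × H) →ₗ.[ℂ] WithLp 2 (H × H) :=
  (L0 A B C).closure

end Block

end BlockOp

end

/-! Put `R = A⁻¹` and `G = C A⁻¹`; both are bounded, `G` by the closed graph theorem. Block
elimination gives `𝓙𝓛 = [[1, 0], [G, 1]] · diag(A, S̄₀) · [[1, G*], [0, 1]]`, where the outer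
factors are bounded with bounded inverses. In terms of graphs this is `mem_L_graph`, and everything
about `𝓛` is read off from it.

Self-adjointness of `A` and `S̄₀` makes `𝓙𝓛` self-adjoint (`isJSelfAdjoint_L`). Eliminating the
first component from `(𝓛 - z) f = g` leaves one equation for the closure of `T(z)`, so `z ∈ ρ(𝓛)`
exactly when `0 ∈ ρ(T̄(z))` (`mem_rho_L_iff`). A definitizing polynomial always exists
(`exists_definitizing_polynomial_L`), so definitizability reduces to `ρ(𝓛) ≠ ∅`.

For the polynomial, the form `a(x, y) = ⟨𝓙𝓛x, y⟩` is the sum of the forms of `A` and `S̄₀`. By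
`re_inner_nonneg_of_orthogonal` it is nonnegative on the kernel of a map of finite rank, so it has
at most some number `n` of negative squares. In finite dimension, an `a`-symmetric operator either
has a nonpositive eigenvector outside the radical, or `a ≥ 0`. Passing to the complement of such an
eigenvector costs one negative square and one linear factor, so after at most `n` rounds `a` is
nonnegative on the range of some `q(T)` (`exists_polynomial_form_nonneg`). Compressions to
finite-dimensional subspaces and compactness of the unit sphere of coefficients give one `q` for all
vectors of `dom 𝓛ⁿ` with the required iterates (`exists_coeff_form_nonneg`). If `q = u + iv` with
`u`, `v` real, then `X^(2n+1) (u² + v²)` is definitizing (`exists_definitizing_polynomial`);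
nonemptiness of the resolvent set plays no role there. -/

namespace BlockOp

open Module ComplexConjugate

/-! ### Hermitian forms with finitely many negative squares. -/

section Hermitian

variable {V : Type*} [AddCommGroup V] [Module ℂ V]

/-- The form `a` is negative definite on `M`. -/
def IsNegDefOn (a : V →ₗ⋆[ℂ] V →ₗ[ℂ] ℂ) (M : Submodule ℂ V) : Prop :=
  ∀ x ∈ M, x ≠ 0 → (a x x).re < 0

/-- The form `a` has at most `n` negative squares. -/
def NegIndexLE (a : V →ₗ⋆[ℂ] V →ₗ[ℂ] ℂ) (n : ℕ) : Prop :=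
  ∀ M : Submodule ℂ V, FiniteDimensional ℂ M → IsNegDefOn a M → finrank ℂ M ≤ n

variable {a : V →ₗ⋆[ℂ] V →ₗ[ℂ] ℂ}

lemma re_form_add (ha : a.IsSymm) (x y : V) :
    (a (x + y) (x + y)).re = (a x x).re + 2 * (a x y).re + (a y y).re := by
  have h : (a y x).re = (a x y).re := by rw [← ha.eq x y]; simp
  simp only [map_add, LinearMap.add_apply, Complex.add_re, h]
  ring

lemma form_comm_eq_zero (ha : a.IsSymm) {x y : V} (h : a x y = 0) : a y x = 0 := by
  rw [← ha.eq x y, h, map_zero]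

lemma re_form_smul (c : ℂ) (x : V) : (a (c • x) (c • x)).re = ‖c‖ ^ 2 * (a x x).re := by
  simp only [map_smulₛₗ, LinearMap.smul_apply, smul_eq_mul, RingHom.id_apply]
  rw [← mul_assoc, Complex.mul_conj, Complex.normSq_eq_norm_sq,
    Complex.re_ofReal_mul]

lemma IsSymm_domRestrict (ha : a.IsSymm) (W : Submodule ℂ V) : (a.domRestrict₁₂ W W).IsSymm :=
  ⟨fun x y => ha.eq (x : V) y⟩

/-- On a finite dimensional space the functionals `a z` are those which vanish on the radical. -/
lemma exists_form_eq [FiniteDimensional ℂ V] (l : Dual ℂ V)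
    (hl : ∀ y, (∀ z, a z y = 0) → l y = 0) : ∃ z, a z = l := by
  have h : l ∈ (LinearMap.range a).dualCoannihilator.dualAnnihilator := by
    rw [Submodule.mem_dualAnnihilator]
    intro y hy
    rw [Submodule.mem_dualCoannihilator] at hy
    exact hl y fun z => hy _ ⟨z, rfl⟩
  rw [Subspace.dualCoannihilator_dualAnnihilator_eq] at h
  exact h

/-- A definite form is nondegenerate on `M`, so every functional on `M` is represented there; `m`
represents the one induced by `x`. -/
lemma IsNegDefOn.exists_orthogonal_decomp {M : Submodule ℂ V}
    [FiniteDimensional ℂ M] (hM : IsNegDefOn a M) (ha : a.IsSymm) (x : V) :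
    ∃ m ∈ M, ∀ n ∈ M, a n (x - m) = 0 := by
  obtain ⟨m, hm⟩ := exists_form_eq (a := a.domRestrict₁₂ M M) ((a x).domRestrict M) (by
    intro y hy
    have : (y : V) = 0 := by
      by_contra h
      have h1 := hM y y.2 h
      have h2 : a (y : V) y = 0 := hy y
      simp [h2] at h1
    simp [this])
  refine ⟨m, m.2, fun n hn => form_comm_eq_zero ha ?_⟩
  have := LinearMap.congr_fun hm ⟨n, hn⟩
  have h : a (m : V) n = a x n := this
  rw [map_sub, LinearMap.sub_apply, h, sub_self]

lemma IsNegDefOn.sup_span {M : Submodule ℂ V} [FiniteDimensional ℂ M] (hM : IsNegDefOn a M)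
    (ha : a.IsSymm) {u : V} (hu : ∀ n ∈ M, a n u = 0) (hneg : (a u u).re < 0) :
    IsNegDefOn a (M ⊔ ℂ ∙ u) ∧ finrank ℂ ↥(M ⊔ ℂ ∙ u) = finrank ℂ M + 1 := by
  have hu0 : u ≠ 0 := by rintro rfl; simp at hneg
  constructor
  · intro x hx hx0
    obtain ⟨m, hm, w, hw, rfl⟩ := Submodule.mem_sup.1 hx
    obtain ⟨c, rfl⟩ := Submodule.mem_span_singleton.1 hw
    rw [re_form_add ha, re_form_smul, map_smul, hu m hm]
    simp only [smul_zero, Complex.zero_re, mul_zero, add_zero]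
    by_cases hc : c = 0
    · subst hc
      have := hM m hm (by simpa using hx0)
      simpa using this
    · have h1 : 0 < ‖c‖ ^ 2 := by positivity
      have h2 : (a m m).re ≤ 0 := by
        by_cases h : m = 0
        · simp [h]
        · exact (hM m hm h).le
      nlinarith
  · have hd : M ⊓ (ℂ ∙ u) = ⊥ := by
      rw [eq_bot_iff]
      rintro x ⟨hx, hx'⟩
      obtain ⟨c, rfl⟩ := Submodule.mem_span_singleton.1 hx'
      by_contra h0
      have h1 := hM _ hx h0
      have h2 := hu _ hx
      rw [map_smul, h2] at h1
      simp at h1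
    have := Submodule.finrank_sup_add_finrank_inf_eq M (ℂ ∙ u)
    rw [hd, finrank_bot, finrank_span_singleton hu0] at this
    simpa using this

/-- A maximal negative definite subspace exists. -/
lemma NegIndexLE.exists_maximal {n : ℕ} (h : NegIndexLE a n) (ha : a.IsSymm) :
    ∃ N : Submodule ℂ V, FiniteDimensional ℂ N ∧ IsNegDefOn a N ∧
      ∀ x, (∀ m ∈ N, a m x = 0) → 0 ≤ (a x x).re := by
  by_contra! hcon
  have key : ∀ k : ℕ, ∃ N : Submodule ℂ V,
      FiniteDimensional ℂ N ∧ IsNegDefOn a N ∧ finrank ℂ N = k := by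
    intro k
    induction k with
    | zero => exact ⟨⊥, inferInstance, fun x hx h0 => (h0 (by simpa using hx)).elim, finrank_bot ..⟩
    | succ k ih =>
      obtain ⟨N, hfd, hN, hk⟩ := ih
      obtain ⟨x, hx, hneg⟩ := hcon N hfd hN
      have := hN.sup_span ha hx hneg
      exact ⟨N ⊔ ℂ ∙ x, inferInstance, this.1, by rw [this.2, hk]⟩
  obtain ⟨N, hfd, hN, hk⟩ := key (n + 1)
  have := h N hfd hN
  omega

/-- A nonconstant real-affine function of `t` is unbounded below. The test value makes the
expression `-p - 2`, while `t = 0` gives `p ≥ 0`. -/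
lemma eq_zero_of_forall_nonneg {p : ℝ} {c : ℂ} (h : ∀ t : ℂ, 0 ≤ p + 2 * (t * c).re) : c = 0 := by
  by_contra hc
  have hc' : 0 < ‖c‖ ^ 2 := by positivity
  have := h (((-(p + 1) / ‖c‖ ^ 2 : ℝ) : ℂ) * conj c)
  rw [mul_assoc, mul_comm (conj c), Complex.mul_conj, Complex.normSq_eq_norm_sq,
    ← Complex.ofReal_mul, Complex.ofReal_re, div_mul_cancel₀ _ hc'.ne'] at this
  have h0 := h 0
  simp at h0
  linarith

/-- The radical of the restriction of `a` to a subspace containing a maximal negative definite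
subspace is contained in the radical of `a`. -/
lemma radical_of_maximal (ha : a.IsSymm) {N E : Submodule ℂ V} [FiniteDimensional ℂ N]
    (hN : IsNegDefOn a N) (hmax : ∀ x, (∀ m ∈ N, a m x = 0) → 0 ≤ (a x x).re) (hNE : N ≤ E)
    {y : V} (hy : y ∈ E) (hrad : ∀ z ∈ E, a z y = 0) (z : V) : a z y = 0 := by
  obtain ⟨m, hm, hmz⟩ := hN.exists_orthogonal_decomp ha z
  -- Adding a multiple of `y` to `z - m` keeps it orthogonal to `N`, and `a y y = 0`, so maximality
  -- bounds a function affine in `t` from below.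
  have h1 : a (z - m) y = 0 := by
    apply eq_zero_of_forall_nonneg (p := (a (z - m) (z - m)).re)
    intro t
    have := hmax (z - m + t • y) (fun n hn => by
      rw [map_add, hmz n hn, map_smul, hrad n (hNE hn), smul_zero, add_zero])
    rw [re_form_add ha, re_form_smul, hrad y hy] at this
    simpa using this
  rw [map_sub, LinearMap.sub_apply, hrad m (hNE hm), sub_zero] at h1
  exact h1

/-- Passing to the orthogonal complement of a nonpositive vector outside the radical lowers the
number of negative squares. -/
lemma NegIndexLE.restrict_orthogonal {n : ℕ} (h : NegIndexLE a n) (ha : a.IsSymm) {v w : V}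
    (hv : (a v v).re ≤ 0) (hw : a v w ≠ 0) :
    ∃ k, n = k + 1 ∧
      NegIndexLE (a.domRestrict₁₂ (LinearMap.ker (a v)) (LinearMap.ker (a v))) k := by
  have key : ∀ M : Submodule ℂ V, FiniteDimensional ℂ M → IsNegDefOn a M →
      M ≤ LinearMap.ker (a v) → finrank ℂ M + 1 ≤ n := by
    intro M _ hM hMv
    -- The vector `u` is sought as `w - m + t • v`, with `m` the projection of `w` to `M`. Both `w -
    -- m` and `v` are orthogonal to `M` and `a v (w - m) = a v w ≠ 0`; as `a v v ≤ 0`, the form is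
    -- negative for some `t`.
    suffices ∃ u, (∀ m ∈ M, a m u = 0) ∧ (a u u).re < 0 by
      obtain ⟨u, hu, hneg⟩ := this
      have := hM.sup_span ha hu hneg
      rw [← this.2]
      exact h _ inferInstance this.1
    have hvM : ∀ m ∈ M, a m v = 0 := fun m hm => form_comm_eq_zero ha (hMv hm)
    obtain ⟨m, hm, hmz⟩ := hM.exists_orthogonal_decomp ha w
    by_contra! hcon
    have h1 : a (w - m) v = 0 := by
      apply eq_zero_of_forall_nonneg (p := (a (w - m) (w - m)).re)
      intro t
      have := hcon (w - m + t • v) (fun n hn => by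
        rw [map_add, hmz n hn, map_smul, hvM n hn, smul_zero, add_zero])
      rw [re_form_add ha, re_form_smul, map_smul, smul_eq_mul] at this
      have h3 : ‖t‖ ^ 2 * (a v v).re ≤ 0 := mul_nonpos_of_nonneg_of_nonpos (by positivity) hv
      linarith
    apply hw
    have h2 := form_comm_eq_zero ha h1
    have h3 : a v m = 0 := hMv hm
    rwa [map_sub, h3, sub_zero] at h2
  have h0 := key ⊥ inferInstance (fun x hx h0 => (h0 (by simpa using hx)).elim) bot_le
  obtain ⟨k, rfl⟩ : ∃ k, n = k + 1 := ⟨n - 1, by omega⟩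
  refine ⟨k, rfl, fun M _ hM => ?_⟩
  have := key (M.map (LinearMap.ker (a v)).subtype) inferInstance (by
    rintro _ ⟨x, hx, rfl⟩ hx0
    exact hM x hx (by rintro rfl; simp at hx0)) (by rintro _ ⟨x, hx, rfl⟩; exact x.2)
  rw [(Submodule.equivMapOfInjective _ Subtype.val_injective M).finrank_eq.symm] at this
  omega

end Hermitian

/-! ### Symmetric operators for an indefinite form in finite dimension. -/

section FiniteDimensional

universe u

/-- A symmetric operator all of whose eigenvectors modulo the radical are positive comes from a
nonnegative form. -/
lemma form_nonneg_of_eigenvectors (n : ℕ) : ∀ {E : Type u} [AddCommGroup E] [Module ℂ E]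
    [FiniteDimensional ℂ E] {a : E →ₗ⋆[ℂ] E →ₗ[ℂ] ℂ} {T : E →ₗ[ℂ] E}, finrank ℂ E ≤ n →
    a.IsSymm → (∀ x y, a (T x) y = a x (T y)) →
    (∀ (c : ℂ) (v w : E), a v w ≠ 0 → (∀ y, a (T v - c • v) y = 0) → 0 < (a v v).re) →
    ∀ x, 0 ≤ (a x x).re := by
  induction n with
  | zero =>
    intro E _ _ _ a T hn ha hT hpos x
    have := Module.finrank_zero_iff.1 (Nat.le_zero.1 hn)
    simp [Subsingleton.elim x 0]
  | succ n ih =>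
    intro E _ _ _ a T hn ha hT hpos x
    by_cases htriv : ∀ x y, a x y = 0
    · simp [htriv]
    push Not at htriv
    obtain ⟨x₀, y₀, hxy⟩ := htriv
    let R : Submodule ℂ E := (LinearMap.ker a)
    have hR : ∀ x, x ∈ R ↔ ∀ y, a x y = 0 := fun x => by
      simp only [R, LinearMap.mem_ker, LinearMap.ext_iff, LinearMap.zero_apply]
    have hRT : R ≤ R.comap T := fun x hx => by
      rw [Submodule.mem_comap, hR]
      intro y
      rw [hT, (hR x).1 hx]
    have hnt : Nontrivial (E ⧸ R) := by
      rw [Submodule.Quotient.nontrivial_iff]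
      intro htop
      exact hxy ((hR x₀).1 (htop ▸ Submodule.mem_top) y₀)
    -- The radical is invariant under `T`, so an eigenvector in the nonzero quotient lifts to an
    -- eigenvector modulo the radical that lies outside it.
    obtain ⟨c, hc⟩ := Module.End.exists_eigenvalue (R.mapQ R T hRT)
    obtain ⟨v', hv'⟩ := hc.exists_hasEigenvector
    obtain ⟨v, rfl⟩ := R.mkQ_surjective v'
    have hv0 : v ∉ R := fun h => hv'.2 (by simpa using h)
    have hv1 : T v - c • v ∈ R := by
      have := hv'.apply_eq_smul
      rw [← Submodule.Quotient.mk_eq_zero, Submodule.Quotient.mk_sub, Submodule.Quotient.mk_smul,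
        sub_eq_zero]
      exact this
    rw [hR] at hv0 hv1
    push Not at hv0
    obtain ⟨w, hw⟩ := hv0
    have hvpos := hpos c v w hw hv1
    have hvv : a v v ≠ 0 := fun h => by simp [h] at hvpos
    have hTv : ∀ y, a (T v) y = conj c * a v y := fun y => by
      have := hv1 y
      rw [map_sub, LinearMap.sub_apply, sub_eq_zero] at this
      simpa using this
    have hTv' : ∀ y, a y (T v) = c * a y v := fun y => by
      rw [← ha.eq, hTv, map_mul, ha.eq, Complex.conj_conj]
    have hcreal : conj c = c := by
      have := (hTv v).symm.trans ((hT v v).trans (hTv' v))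
      exact mul_right_cancel₀ hvv this
    let W := LinearMap.ker (a v)
    have hTW : ∀ y ∈ W, T y ∈ W := fun y hy => by
      have hy' : a v y = 0 := hy
      change a v (T y) = 0
      rw [← hT, hTv, hy', mul_zero]
    have hdec : ∀ x, x - (a v x / a v v) • v ∈ W := fun x => by
      change a v _ = 0
      rw [map_sub, map_smul, smul_eq_mul, div_mul_cancel₀ _ hvv, sub_self]
    have hWv : ∀ y ∈ W, a y v = 0 := fun y hy => form_comm_eq_zero ha hy
    have hfin : finrank ℂ W ≤ n := by
      have hlt : W < ⊤ := by
        rw [lt_top_iff_ne_top]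
        intro h
        exact hvv (show v ∈ W from h ▸ Submodule.mem_top)
      have := Submodule.finrank_lt hlt.ne
      omega
    have hWnonneg := ih (a := a.domRestrict₁₂ W W) (T := T.restrict hTW) hfin
      (IsSymm_domRestrict ha W) (fun x y => hT x y) (by
        -- An eigenvector modulo the radical of `a` on `W` is one modulo the radical of `a` on `E`:
        -- the defect `T x - d • x` lies in `W`, hence is also orthogonal to `v`.
        intro d x y hxy hx
        refine hpos d x y hxy fun z => ?_
        have h1 : a (T x - d • (x : E)) (z - (a v z / a v v) • v) = 0 := hx ⟨_, hdec z⟩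
        have h2 : a (T x - d • (x : E)) v = 0 :=
          hWv _ (W.sub_mem (hTW x x.2) (W.smul_mem d x.2))
        rwa [map_sub, map_smul, h2, smul_zero, sub_zero] at h1)
    have h1 : 0 ≤ (a (x - (a v x / a v v) • v) (x - (a v x / a v v) • v)).re :=
      hWnonneg ⟨_, hdec x⟩
    rw [← sub_add_cancel x ((a v x / a v v) • v), re_form_add ha, re_form_smul, map_smul,
      hWv _ (hdec x)]
    simp only [smul_zero, Complex.zero_re, mul_zero, add_zero]
    positivity

/-- An operator symmetric for a form with at most `n` negative squares on a finite dimensional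
space: the form is nonnegative on the range of a monic polynomial of degree at most `n` in the
operator. -/
lemma exists_polynomial_form_nonneg (n : ℕ) : ∀ {E : Type u} [AddCommGroup E] [Module ℂ E]
    [FiniteDimensional ℂ E] {a : E →ₗ⋆[ℂ] E →ₗ[ℂ] ℂ} {T : E →ₗ[ℂ] E}, NegIndexLE a n →
    a.IsSymm → (∀ x y, a (T x) y = a x (T y)) →
    ∃ q : Polynomial ℂ, q.Monic ∧ q.natDegree ≤ n ∧
      ∀ x, 0 ≤ (a (q.aeval T x) (q.aeval T x)).re := by
  induction n with
  | zero =>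
    intro E _ _ _ a T hn ha hT
    refine ⟨1, Polynomial.monic_one, by simp, fun x => ?_⟩
    rw [map_one, Module.End.one_apply]
    by_contra! hx
    have hx0 : x ≠ 0 := by rintro rfl; simp at hx
    have := hn (⊥ ⊔ ℂ ∙ x) inferInstance
      (IsNegDefOn.sup_span (M := ⊥) (fun x hx h0 => (h0 (by simpa using hx)).elim) ha
        (by intro n hn; simp [(Submodule.mem_bot ℂ).1 hn]) hx).1
    rw [bot_sup_eq, finrank_span_singleton hx0] at this
    omega
  | succ n ih =>
    intro E _ _ _ a T hn ha hT
    by_cases hpos : ∀ (c : ℂ) (v w : E), a v w ≠ 0 → (∀ y, a (T v - c • v) y = 0) →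
        0 < (a v v).re
    · refine ⟨1, Polynomial.monic_one, by simp, fun x => ?_⟩
      rw [map_one, Module.End.one_apply]
      exact form_nonneg_of_eigenvectors _ le_rfl ha hT hpos x
    push Not at hpos
    obtain ⟨c, v, w, hw, hv, hvneg⟩ := hpos
    have hTv : ∀ y, a (T v) y = conj c * a v y := fun y => by
      have := hv y
      rw [map_sub, LinearMap.sub_apply, sub_eq_zero] at this
      simpa using this
    obtain ⟨k, hk, hidx⟩ := hn.restrict_orthogonal ha hvneg hw
    obtain rfl : n = k := by omega
    let W := LinearMap.ker (a v)
    have hTW : ∀ y ∈ W, T y ∈ W := fun y hy => by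
      have hy' : a v y = 0 := hy
      change a v (T y) = 0
      rw [← hT, hTv, hy', mul_zero]
    obtain ⟨q, hq, hdeg, hnn⟩ := ih (T := T.restrict hTW) hidx (IsSymm_domRestrict ha W)
      (fun x y => hT x y)
    -- Since `a (T v) y = conj c * a v y`, the operator `T - conj c` maps all of `E` into the
    -- orthogonal complement `W` of `v`, where the induction hypothesis applies.
    refine ⟨q * (Polynomial.X - Polynomial.C (conj c)), hq.mul (Polynomial.monic_X_sub_C _), ?_,
      fun x => ?_⟩
    · rw [hq.natDegree_mul (Polynomial.monic_X_sub_C _), Polynomial.natDegree_X_sub_C]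
      omega
    have hx : T x - conj c • x ∈ W := by
      change a v _ = 0
      rw [map_sub, map_smul, ← hT, hTv, smul_eq_mul, sub_self]
    have hcoe : ∀ (p : Polynomial ℂ) (y : W),
        ((p.aeval (T.restrict hTW) y : W) : E) = p.aeval T (y : E) := by
      intro p y
      induction p using Polynomial.induction_on' with
      | add p q hp hq => simp [hp, hq]
      | monomial m c =>
        simp only [Polynomial.aeval_monomial, Module.End.mul_apply, Module.algebraMap_end_apply,
          Submodule.coe_smul]
        congr 1
        induction m generalizing y with
        | zero => simp
        | succ m ihm =>
          rw [pow_succ, pow_succ, Module.End.mul_apply, Module.End.mul_apply, ihm]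
          rfl
    have := hnn ⟨_, hx⟩
    rw [map_mul, Module.End.mul_apply]
    have h2 : (Polynomial.aeval T (Polynomial.X - Polynomial.C (conj c))) x = T x - conj c • x := by
      simp
    rw [h2]
    change 0 ≤ (a (Polynomial.aeval (T.restrict hTW) q ⟨_, hx⟩ : W)
      (Polynomial.aeval (T.restrict hTW) q ⟨_, hx⟩ : W)).re at this
    rwa [hcoe] at this

end FiniteDimensional

/-! ### Compression to finite-dimensional subspaces and compactness. -/

section Compression

variable {V : Type*} [AddCommGroup V] [Module ℂ V] {a b : V →ₗ⋆[ℂ] V →ₗ[ℂ] ℂ}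

/-- A form `b` which vanishes on the radical of `a` is represented by an operator. -/
lemma exists_operator_form_eq [FiniteDimensional ℂ V]
    (hrad : ∀ y, (∀ z, a z y = 0) → ∀ z, b z y = 0) :
    ∃ T : V →ₗ[ℂ] V, (∀ x y, a (T x) y = b x y) := by
  have h : ∀ x, ∃ z, a z = b x := fun x => exists_form_eq (b x) fun y hy => hrad y hy x
  choose f hf using h
  let e := Module.finBasis ℂ V
  refine ⟨e.constr ℂ fun i => f (e i), fun x y => ?_⟩
  have : a.comp (e.constr ℂ fun i => f (e i)) = b := e.ext fun i => by simp [hf]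
  exact LinearMap.congr_fun (LinearMap.congr_fun this x) y

/-- For forms `a` and `b`, of which `a` has at most `n` negative squares and `b` is formally
`a (T ·) ·`, there are coefficients of a polynomial `q` such that `a` is nonnegative
on `q(T) x` for all `x` for which this is defined. The values `T ^ k x` are given by a sequence. -/
theorem exists_coeff_form_nonneg (ha : a.IsSymm) (hb : b.IsSymm)
    (hrad : ∀ y, (∀ z, a z y = 0) → ∀ z, b z y = 0) {n : ℕ} (hn : NegIndexLE a n) :
    ∃ c : Fin (n + 1) → ℂ, c ≠ 0 ∧ ∀ x : ℕ → V, (∀ k < n, ∀ y, b (x k) y = a (x (k + 1)) y) →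
      0 ≤ (a (∑ i, c i • x i) (∑ i, c i • x i)).re := by
  obtain ⟨N, hNfd, hN, hmax⟩ := hn.exists_maximal ha
  let ι := {x : ℕ → V // ∀ k < n, ∀ y, b (x k) y = a (x (k + 1)) y}
  let t : ι → Set (Fin (n + 1) → ℂ) := fun x =>
    {c | 0 ≤ (a (∑ i, c i • x.1 i) (∑ i, c i • x.1 i)).re}
  have hclosed : ∀ x, IsClosed (t x) := by
    intro x
    refine isClosed_le continuous_const (Complex.continuous_re.comp ?_)
    simp only [map_sum, LinearMap.sum_apply, map_smulₛₗ, LinearMap.smul_apply, RingHom.id_apply]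
    fun_prop
  suffices (Metric.sphere (0 : Fin (n + 1) → ℂ) 1 ∩ ⋂ x, t x).Nonempty by
    obtain ⟨c, hc, hct⟩ := this
    refine ⟨c, ?_, fun x hx => Set.mem_iInter.1 hct ⟨x, hx⟩⟩
    rintro rfl
    simp at hc
  refine (isCompact_sphere _ _).inter_iInter_nonempty t hclosed fun u => ?_
  let F : Submodule ℂ V := ⨆ x ∈ u, Submodule.span ℂ (Set.range fun i : Fin (n + 1) => x.1 i)
  have hF : FiniteDimensional ℂ F := by
    have := fun x : ι => FiniteDimensional.span_of_finite ℂ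
      (Set.finite_range fun i : Fin (n + 1) => x.1 i)
    exact Submodule.finiteDimensional_finset_sup u _ |> fun h => by
      rw [Finset.sup_eq_iSup] at h; exact h
  have hxF : ∀ x ∈ u, ∀ k ≤ n, x.1 k ∈ F := fun x hx k hk =>
    (le_iSup₂ (f := fun (x : ι) (_ : x ∈ u) =>
      Submodule.span ℂ (Set.range fun i : Fin (n + 1) => x.1 i)) x hx)
      (Submodule.subset_span ⟨⟨k, by omega⟩, rfl⟩)
  -- `F` holds the finitely many given sequences. Including the maximal negative subspace `N` puts
  -- the radical of `a` on `E` inside the radical of `a`, so `b` vanishes on it and is represented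
  -- by an operator on `E`.
  let E := N ⊔ F
  obtain ⟨T, hT⟩ := exists_operator_form_eq (a := a.domRestrict₁₂ E E) (b := b.domRestrict₁₂ E E)
    (fun y hy z => hrad y
      (radical_of_maximal ha hN hmax le_sup_left y.2 fun z hz => hy ⟨z, hz⟩) z)
  have hTE : ∀ x y : E, a (T x) y = b x y := hT
  have hTsymm : ∀ x y, a.domRestrict₁₂ E E (T x) y = a.domRestrict₁₂ E E x (T y) := by
    intro x y
    rw [hT, ← (IsSymm_domRestrict hb E).eq, ← hT, (IsSymm_domRestrict ha E).eq]
  have hidx : NegIndexLE (a.domRestrict₁₂ E E) n := by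
    intro M _ hM
    have := hn (M.map E.subtype) inferInstance (by
      rintro _ ⟨x, hx, rfl⟩ hx0
      exact hM x hx (by rintro rfl; simp at hx0))
    rwa [(Submodule.equivMapOfInjective _ Subtype.val_injective M).finrank_eq.symm] at this
  obtain ⟨q, hq, hdeg, hnn⟩ := exists_polynomial_form_nonneg n hidx (IsSymm_domRestrict ha E) hTsymm
  let c : Fin (n + 1) → ℂ := fun i => q.coeff i
  have hc : c ≠ 0 := fun h => by
    have : q.coeff q.natDegree = 0 := congrFun h ⟨q.natDegree, by omega⟩
    rw [hq.coeff_natDegree] at this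
    exact one_ne_zero this
  have hc' : ‖c‖ ≠ 0 := norm_ne_zero_iff.2 hc
  have hct : ∀ x ∈ u, c ∈ t x := by
    intro x hx
    have hE : ∀ k ≤ n, x.1 k ∈ E := fun k hk => (le_sup_right : F ≤ E) (hxF x hx k hk)
    -- The operator `T` is fixed only modulo the radical, so its powers reproduce the sequence only
    -- up to radical vectors. This is enough, because neither `a` nor `b` sees such vectors.
    have hrad_pow : ∀ k, (hk : k ≤ n) → ∀ y ∈ E,
        a (((T ^ k) ⟨x.1 0, hE 0 n.zero_le⟩ : E) - x.1 k) y = 0 := by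
      intro k
      induction k with
      | zero => intro _ y hy; simp
      | succ k ih =>
        intro hk y hy
        have h1 := hTE ((T ^ k) ⟨x.1 0, hE 0 n.zero_le⟩) ⟨y, hy⟩
        have h2 := x.2 k (by omega) y
        have h3 : b (((T ^ k) ⟨x.1 0, hE 0 n.zero_le⟩ : E) - x.1 k) y = 0 := by
          apply form_comm_eq_zero hb
          refine hrad _ (fun z => radical_of_maximal ha hN hmax le_sup_left
            (E.sub_mem (Subtype.coe_prop _) (hE k (by omega))) (fun w hw => ?_) z) _
          exact form_comm_eq_zero ha (ih (by omega) w hw)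
        rw [map_sub, LinearMap.sub_apply] at h3 ⊢
        rw [pow_succ', Module.End.mul_apply, h1, ← h2, h3]
    have h0 := hnn ⟨x.1 0, hE 0 n.zero_le⟩
    set z : E := (Polynomial.aeval T) q ⟨x.1 0, hE 0 n.zero_le⟩ with hz
    have hzsum : z = ∑ i : Fin (n + 1), c i • (T ^ (i : ℕ)) ⟨x.1 0, hE 0 n.zero_le⟩ := by
      rw [hz, Polynomial.aeval_eq_sum_range' (Nat.lt_succ_of_le hdeg), LinearMap.sum_apply,
        ← Fin.sum_univ_eq_sum_range
          (fun i => (q.coeff i • T ^ i) (⟨x.1 0, hE 0 n.zero_le⟩ : E)) (n + 1)]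
      rfl
    have hsumE : ∑ i, c i • x.1 (i : ℕ) ∈ E :=
      E.sum_mem fun i _ => E.smul_mem _ (hE i (by omega))
    have hdiff : ∀ y ∈ E, a ((z : V) - ∑ i, c i • x.1 (i : ℕ)) y = 0 := by
      intro y hy
      rw [hzsum, Submodule.coe_sum, ← Finset.sum_sub_distrib, map_sum, LinearMap.sum_apply]
      refine Finset.sum_eq_zero fun i _ => ?_
      rw [Submodule.coe_smul, ← smul_sub, map_smulₛₗ, LinearMap.smul_apply,
        hrad_pow i (by omega) y hy, smul_zero]
    have h1 : a (z : V) z = a (∑ i, c i • x.1 (i : ℕ)) (∑ i, c i • x.1 (i : ℕ)) := by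
      have e1 := hdiff z z.2
      have e2 := form_comm_eq_zero ha (hdiff _ hsumE)
      rw [map_sub, LinearMap.sub_apply, sub_eq_zero] at e1
      rw [map_sub, sub_eq_zero] at e2
      rw [e1, e2]
    change 0 ≤ (a (z : V) z).re at h0
    rw [h1] at h0
    exact h0
  -- Scaling `c` multiplies the form by a positive factor, so the solution can be moved to the unit
  -- sphere.
  refine ⟨((‖c‖⁻¹ : ℝ) : ℂ) • c, by simp [norm_smul, hc'], Set.mem_iInter₂.2 fun x hx => ?_⟩
  have := hct x hx
  simp only [t, Set.mem_ofPred_eq, Pi.smul_apply, smul_assoc, ← Finset.smul_sum] at this ⊢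
  rw [re_form_smul]
  positivity

/-- The number of negative squares is bounded by the codimension of a subspace on which the form is
nonnegative. -/
lemma negIndexLE_of_ker {W : Type*} [AddCommGroup W] [Module ℂ W] [FiniteDimensional ℂ W]
    (f : V →ₗ[ℂ] W) (h : ∀ x, f x = 0 → 0 ≤ (a x x).re) : NegIndexLE a (finrank ℂ W) := by
  intro M _ hM
  refine LinearMap.finrank_le_finrank_of_injective (f := f.domRestrict M) ?_
  rw [← LinearMap.ker_eq_bot, LinearMap.ker_eq_bot']
  intro x hx
  by_contra hx0
  have := hM x x.2 (by simpa using hx0)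
  have := h x hx
  linarith

end Compression

/-! ### Powers of an operator and the definitizing polynomial. -/

section Definitizable

variable {K : Type*} [NormedAddCommGroup K] [InnerProductSpace ℂ K]

lemma sum_apply_of_eq {ι : Type*} (F : ι → K →ₗ.[ℂ] K) (g : ι → K) {x : K} (s : Finset ι) :
    ∀ hx : x ∈ (∑ i ∈ s, F i).domain, (∀ i ∈ s, ∀ h : x ∈ (F i).domain, F i ⟨x, h⟩ = g i) →
      (∀ i ∈ s, x ∈ (F i).domain) ∧ (∑ i ∈ s, F i) ⟨x, hx⟩ = ∑ i ∈ s, g i := by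
  classical
  induction s using Finset.induction_on with
  | empty => intro hx _; simp
  | insert i s hi ih =>
    rw [Finset.sum_insert hi, Finset.sum_insert hi]
    intro hx hg
    have h1 := ih hx.2 fun j hj => hg j (Finset.mem_insert_of_mem hj)
    refine ⟨fun j hj => ?_, ?_⟩
    · rcases Finset.mem_insert.1 hj with rfl | hj
      · exact hx.1
      · exact h1.1 j hj
    · rw [← h1.2, ← hg i (Finset.mem_insert_self i s) hx.1]
      rfl

lemma mem_mulMax_domain {S T : K →ₗ.[ℂ] K} {x : K} :
    x ∈ (mulMax S T).domain ↔ ∃ h : x ∈ T.domain, T ⟨x, h⟩ ∈ S.domain := by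
  constructor
  · rintro ⟨y, hy, rfl⟩
    exact ⟨y.2, hy⟩
  · rintro ⟨h, h'⟩
    exact ⟨⟨x, h⟩, h', rfl⟩

/-- The sequence of the vectors `T ^ k f`. -/
lemma exists_powMax_seq (T : K →ₗ.[ℂ] K) (n : ℕ) {f : K} (hf : f ∈ (powMax T n).domain) :
    ∃ x : ℕ → K, x 0 = f ∧ (∀ k < n, ∃ h : x k ∈ T.domain, T ⟨x k, h⟩ = x (k + 1)) ∧
      ∀ k ≤ n, ∀ h : f ∈ (powMax T k).domain, powMax T k ⟨f, h⟩ = x k := by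
  classical
  have hmem : ∀ m, ∀ k ≤ m, f ∈ (powMax T m).domain → f ∈ (powMax T k).domain := by
    intro m
    induction m with
    | zero => intro k hk h; rwa [Nat.le_zero.1 hk]
    | succ m ih =>
      intro k hk h
      rcases Nat.le_succ_iff.1 hk with hk | rfl
      · exact ih k hk (mem_mulMax_domain.1 h).1
      · exact h
  refine ⟨fun k => if h : f ∈ (powMax T k).domain then powMax T k ⟨f, h⟩ else 0, ?_, ?_, ?_⟩
  · have : f ∈ (powMax T 0).domain := Submodule.mem_top
    simp only [this, dif_pos]
    rfl
  · intro k hk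
    have h1 := hmem n (k + 1) hk hf
    have h0 := hmem n k hk.le hf
    simp only [h0, h1, dif_pos]
    exact ⟨(mem_mulMax_domain.1 h1).2, rfl⟩
  · intro k _ h
    simp only [h, dif_pos]

/-- An operator with `J L` symmetric, whose form `⟨J L f, f⟩` has finitely many negative squares,
has a definitizing polynomial. -/
theorem exists_definitizing_polynomial {J : K →L[ℂ] K} {L : K →ₗ.[ℂ] K}
    (hJ : ∀ x y, inner ℂ (J x) y = inner ℂ x (J y)) (hJ0 : ∀ x, J x = 0 → x = 0)
    (hL : ∀ x y : L.domain, inner ℂ (J (L x)) (y : K) = inner ℂ (x : K) (J (L y)))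
    (hdense : Dense (L.domain : Set K)) {W : Type*} [AddCommGroup W] [Module ℂ W]
    [FiniteDimensional ℂ W] (g : L.domain →ₗ[ℂ] W)
    (hg : ∀ x, g x = 0 → 0 ≤ (inner ℂ (J (L x)) (x : K)).re) :
    ∃ p : Polynomial ℝ, p ≠ 0 ∧
      ∀ f : (polyOp p L).domain, 0 ≤ inner ℂ (J (polyOp p L f)) (f : K) := by
  classical
  let a : L.domain →ₗ⋆[ℂ] L.domain →ₗ[ℂ] ℂ :=
    LinearMap.mk₂'ₛₗ (starRingEnd ℂ) (RingHom.id ℂ) (fun x y => inner ℂ (J (L x)) (y : K))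
      (fun x y z => by simp [LinearPMap.map_add])
      (fun c x y => by simp [LinearPMap.map_smul, mul_comm])
      (fun x y z => by simp)
      (fun c x y => by simp)
  let b : L.domain →ₗ⋆[ℂ] L.domain →ₗ[ℂ] ℂ :=
    LinearMap.mk₂'ₛₗ (starRingEnd ℂ) (RingHom.id ℂ) (fun x y => inner ℂ (J (L x)) (L y))
      (fun x y z => by simp [LinearPMap.map_add])
      (fun c x y => by simp [LinearPMap.map_smul, mul_comm])
      (fun x y z => by simp [LinearPMap.map_add])
      (fun c x y => by simp [LinearPMap.map_smul])
  have ha : a.IsSymm := ⟨fun x y => by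
    change conj (inner ℂ (J (L x)) (y : K)) = inner ℂ (J (L y)) (x : K)
    rw [inner_conj_symm, hL]⟩
  have hb : b.IsSymm := ⟨fun x y => by
    change conj (inner ℂ (J (L x)) (L y)) = inner ℂ (J (L y)) (L x)
    rw [inner_conj_symm, hJ]⟩
  have hrad : ∀ y, (∀ z, a z y = 0) → ∀ z, b z y = 0 := by
    intro y hy z
    have h1 : J (L y) = 0 := hdense.eq_zero_of_inner_right (𝕜 := ℂ) fun w hw => by
      have : inner ℂ (J (L ⟨w, hw⟩)) (y : K) = 0 := hy ⟨w, hw⟩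
      rw [← hL ⟨w, hw⟩, this]
    change inner ℂ (J (L z)) (L y) = 0
    rw [hJ0 _ h1, inner_zero_right]
  obtain ⟨n, hn⟩ : ∃ n, NegIndexLE a n := ⟨_, negIndexLE_of_ker g hg⟩
  obtain ⟨c, hc0, hc⟩ := exists_coeff_form_nonneg ha hb hrad hn
  obtain ⟨d, hd, hdmax⟩ : ∃ d : Fin (n + 1), c d ≠ 0 ∧ ∀ i, c i ≠ 0 → i ≤ d := by
    have hne : (Finset.univ.filter fun i => c i ≠ 0).Nonempty := by
      by_contra! h
      apply hc0
      funext i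
      by_contra hi
      have : i ∈ Finset.univ.filter fun i => c i ≠ 0 := by simpa using hi
      rw [h] at this
      simp at this
    refine ⟨Finset.max' _ hne, ?_, fun i hi => Finset.le_max' _ _ (by simpa using hi)⟩
    have := Finset.max'_mem _ hne
    rw [Finset.mem_filter] at this
    exact this.2
  let poly : (Fin (n + 1) → ℝ) → Polynomial ℝ := fun r =>
    ∑ i, Polynomial.C (r i) * Polynomial.X ^ (i : ℕ)
  have hpoly_coeff : ∀ r (i : Fin (n + 1)), (poly r).coeff i = r i := by
    intro r i
    simp [poly, Polynomial.finsetSum_coeff, Polynomial.coeff_X_pow, ← Fin.ext_iff]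
  have hpoly_deg : ∀ r, (∀ i, c i = 0 → r i = 0) → (poly r).natDegree ≤ d := by
    intro r hr
    refine Polynomial.natDegree_sum_le_of_forall_le _ _ fun i _ => ?_
    by_cases hi : c i = 0
    · simp [hr i hi]
    · exact (Polynomial.natDegree_C_mul_X_pow_le _ _).trans (hdmax i hi)
  let u := poly fun i => (c i).re
  let v := poly fun i => (c i).im
  -- With `q = u + iv`, formally `⟨J p(L) f, f⟩ = a (q(L) Lⁿ f) (q(L) Lⁿ f)`: one factor `X` is the
  -- `L` inside `a`, and `2n` of them shift both arguments by `Lⁿ`. They force `deg p ≥ 2n + 1`, so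
  -- that `L^(n+k) f` lies in `dom L` for all `k ≤ n` even if `q` has degree below `n`.
  let p := Polynomial.X ^ (2 * n + 1) * (u ^ 2 + v ^ 2)
  have hpcoeff : p.coeff (2 * d + (2 * n + 1)) ≠ 0 := by
    rw [Polynomial.coeff_X_pow_mul, Polynomial.coeff_add,
      Polynomial.coeff_pow_of_natDegree_le (hpoly_deg _ fun i hi => by simp [hi]),
      Polynomial.coeff_pow_of_natDegree_le (hpoly_deg _ fun i hi => by simp [hi]),
      hpoly_coeff, hpoly_coeff]
    intro h
    apply hd
    apply Complex.ext <;> simp <;> nlinarith [sq_nonneg (c d).re, sq_nonneg (c d).im]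
  have hdeg := Polynomial.le_natDegree_of_ne_zero hpcoeff
  refine ⟨p, fun h => hpcoeff (by simp [h]), fun f => ?_⟩
  have hfdom : (f : K) ∈ (powMax L p.natDegree).domain := by
    have hf := f.2
    -- Only the domain half is wanted, so the prescribed values are the summands' own, with default
    -- `0`.
    exact (sum_apply_of_eq _ (fun i => if h : (f : K) ∈ (((p.coeff i : ℝ) : ℂ) • powMax L i).domain
      then (((p.coeff i : ℝ) : ℂ) • powMax L i) ⟨f, h⟩ else 0) _ hf (fun i _ h => by
        rw [dif_pos h])).1 p.natDegree (by simp)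
  obtain ⟨x, hx0, hxL, hxpow⟩ := exists_powMax_seq L p.natDegree hfdom
  have hfval : polyOp p L f = ∑ k ∈ Finset.range (p.natDegree + 1), ((p.coeff k : ℝ) : ℂ) • x k :=
    (sum_apply_of_eq _ (fun k => ((p.coeff k : ℝ) : ℂ) • x k) _ f.2 (fun i hi h => by
      rw [LinearPMap.smul_apply, hxpow i (by simpa [Nat.lt_succ_iff] using hi)])).2
  let s : ℕ → ℂ := fun m => inner ℂ (J (x m)) (x 0)
  -- `J`-symmetry moves powers of `L` across the product, so the Gram matrix is a Hankel matrix of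
  -- moments, which `hsreal` shows to be real.
  have hs : ∀ k j, j + k ≤ p.natDegree → inner ℂ (J (x j)) (x k) = s (j + k) := by
    intro k
    induction k with
    | zero => intro j _; rfl
    | succ k ih =>
      intro j hjk
      obtain ⟨h1, h2⟩ := hxL k (by omega)
      obtain ⟨h3, h4⟩ := hxL j (by omega)
      rw [← h2, hJ, ← hL ⟨x j, h3⟩ ⟨x k, h1⟩, h4, ih _ (by omega)]
      congr 1
      omega
  have hsreal : ∀ m ≤ p.natDegree, ((s m).re : ℂ) = s m := by
    intro m hm
    rw [← Complex.conj_eq_iff_re]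
    change conj (inner ℂ (J (x m)) (x 0)) = _
    rw [inner_conj_symm, ← hJ, hs m 0 (by omega), zero_add]
  let mom : Polynomial ℝ →ₗ[ℝ] ℂ := Polynomial.lsum fun m => LinearMap.toSpanSingleton ℝ ℂ (s m)
  have hmom : ∀ (m : ℕ) (r : ℝ), mom (Polynomial.C r * Polynomial.X ^ m) = r * s m := by
    intro m r
    rw [Polynomial.C_mul_X_pow_eq_monomial]
    simp [mom, Polynomial.lsum_apply, Polynomial.sum_monomial_index]
  have hval : inner ℂ (J (polyOp p L f)) (f : K) = mom p := by
    rw [hfval, map_sum, sum_inner, Polynomial.lsum_apply,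
      Polynomial.sum_over_range _ (by simp)]
    refine Finset.sum_congr rfl fun k _ => ?_
    rw [map_smul, inner_smul_left, Complex.conj_ofReal, ← hx0]
    simp [s]
  have hpval : mom p = ∑ i, ∑ j, (((conj (c i) * c j).re : ℝ) : ℂ) * s (2 * n + 1 + i + j) := by
    have hexp : p = ∑ i : Fin (n + 1), ∑ j : Fin (n + 1), Polynomial.C (conj (c i) * c j).re *
        Polynomial.X ^ (2 * n + 1 + (i : ℕ) + (j : ℕ)) := by
      simp only [p, u, v, poly, sq, Finset.sum_mul_sum]
      simp only [← Finset.sum_add_distrib, Finset.mul_sum]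
      refine Finset.sum_congr rfl fun i _ => Finset.sum_congr rfl fun j _ => ?_
      simp only [Complex.mul_re, Complex.conj_re, Complex.conj_im, map_sub, map_mul, map_neg]
      ring
    rw [hexp]
    simp only [map_sum, hmom]
  have hbound : ∀ i j, c i ≠ 0 → c j ≠ 0 → 2 * n + 1 + (i : ℕ) + (j : ℕ) ≤ p.natDegree := by
    intro i j hi hj
    have h1 : (i : ℕ) ≤ d := hdmax i hi
    have h2 : (j : ℕ) ≤ d := hdmax j hj
    omega
  -- The shifted orbit; the default `0` is never met for `k ≤ n`.
  let y : ℕ → L.domain := fun k => if h : x (n + k) ∈ L.domain then ⟨x (n + k), h⟩ else 0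
  have hy : ∀ k ≤ n, (y k : K) = x (n + k) ∧ L (y k) = x (n + k + 1) := by
    intro k hk
    obtain ⟨h1, h2⟩ := hxL (n + k) (by omega)
    simp only [y, h1, dif_pos]
    exact ⟨trivial, h2⟩
  have hnn := hc y fun k hk z => by
    change inner ℂ (J (L (y k))) (L z) = inner ℂ (J (L (y (k + 1)))) (z : K)
    rw [(hy k hk.le).2, hL, (hy (k + 1) hk).1, hJ]
    rfl
  have hform : (a (∑ i, c i • y i) (∑ i, c i • y i)).re =
      ∑ i, ∑ j, (conj (c i) * c j).re * (s (2 * n + 1 + i + j)).re := by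
    simp only [map_sum, LinearMap.sum_apply, map_smulₛₗ, LinearMap.smul_apply, RingHom.id_apply,
      Finset.smul_sum, Complex.re_sum]
    rw [Finset.sum_comm]
    -- Terms with a zero coefficient are discarded first, since their moments may have index beyond
    -- the degree of `p`.
    refine Finset.sum_congr rfl fun i _ => Finset.sum_congr rfl fun j _ => ?_
    by_cases hi : c i = 0
    · simp [hi]
    by_cases hj : c j = 0
    · simp [hj]
    have h1 : a (y i) (y j) = s (2 * n + 1 + i + j) := by
      change inner ℂ (J (L (y i))) (y j : K) = _
      have := hbound i j hi hj
      rw [(hy i (by omega)).2, (hy j (by omega)).1, hs _ _ (by omega)]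
      congr 1
      omega
    rw [h1, ← hsreal _ (hbound i j hi hj)]
    simp only [smul_eq_mul, Complex.ofReal_re]
    rw [← mul_assoc, Complex.re_mul_ofReal, mul_comm (c j)]
  rw [hval, hpval]
  have hreal : ∑ i, ∑ j, (((conj (c i) * c j).re : ℝ) : ℂ) * s (2 * n + 1 + i + j) =
      ((∑ i, ∑ j, (conj (c i) * c j).re * (s (2 * n + 1 + i + j)).re : ℝ) : ℂ) := by
    push_cast
    refine Finset.sum_congr rfl fun i _ => Finset.sum_congr rfl fun j _ => ?_
    by_cases hi : c i = 0
    · simp [hi]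
    by_cases hj : c j = 0
    · simp [hj]
    rw [hsreal _ (hbound i j hi hj)]
  rw [hreal, ← hform]
  exact_mod_cast hnn

end Definitizable

/-! ### Resolvents of self-adjoint operators. -/

section Resolvent

variable {K : Type*} [NormedAddCommGroup K] [InnerProductSpace ℂ K]

/-- This form mentions no domains, so resolvents can be compared by rewriting graphs. -/
lemma isResolventAt_iff {T : K →ₗ.[ℂ] K} {z : ℂ} {R : K →L[ℂ] K} :
    IsResolventAt T z R ↔ ∀ f h : K, (f, h) ∈ T.graph ↔ R (h - z • f) = f := by
  constructor
  · rintro ⟨h1, h2⟩ f h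
    constructor
    · intro hf
      obtain ⟨y, rfl, rfl⟩ := (LinearPMap.mem_graph_iff T).1 hf
      exact h1 y
    · intro hf
      obtain ⟨hd, he⟩ := h2 (h - z • f)
      rw [LinearPMap.mem_graph_iff]
      refine ⟨⟨_, hd⟩, hf, ?_⟩
      rw [show z • R (h - z • f) = z • f by rw [hf]] at he
      exact sub_left_injective he
  · intro H
    refine ⟨fun f => (H _ _).1 (T.mem_graph f), fun g => ?_⟩
    have := (H (R g) (g + z • R g)).2 (by rw [add_sub_cancel_right])
    obtain ⟨y, hy, hy'⟩ := (LinearPMap.mem_graph_iff T).1 this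
    dsimp only at hy hy'
    have hd : R g ∈ T.domain := hy ▸ y.2
    obtain rfl : y = ⟨R g, hd⟩ := Subtype.ext hy
    exact ⟨hd, by rw [hy', add_sub_cancel_right]⟩

variable [CompleteSpace K]

lemma inner_apply_symm {T : K →ₗ.[ℂ] K} (hT : IsSelfAdjoint T) (x y : T.domain) :
    inner ℂ (T x) (y : K) = inner ℂ (x : K) (T y) := by
  have h := LinearPMap.adjoint_isFormalAdjoint hT.dense_domain
  rw [LinearPMap.isSelfAdjoint_def.1 hT] at h
  exact h x y

lemma mem_graph_of_forall_inner {T : K →ₗ.[ℂ] K} (hT : IsSelfAdjoint T) {x y : K}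
    (h : ∀ f : T.domain, inner ℂ y (f : K) = inner ℂ x (T f)) : (x, y) ∈ T.graph := by
  have hx := LinearPMap.mem_adjoint_domain_of_exists x ⟨y, h⟩
  have hy := LinearPMap.adjoint_apply_eq hT.dense_domain ⟨x, hx⟩ h
  rw [← LinearPMap.isSelfAdjoint_def.1 hT, LinearPMap.mem_graph_iff]
  exact ⟨⟨x, hx⟩, rfl, hy⟩

lemma abs_im_mul_norm_le {T : K →ₗ.[ℂ] K} (hT : IsSelfAdjoint T) (z : ℂ) (x : T.domain) :
    |z.im| * ‖(x : K)‖ ≤ ‖T x - z • (x : K)‖ := by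
  have h1 : (inner ℂ (x : K) (T x - z • (x : K))).im = -(z.im * ‖(x : K)‖ ^ 2) := by
    have hreal : (inner ℂ (x : K) (T x)).im = 0 := by
      rw [← Complex.conj_eq_iff_im, inner_conj_symm, inner_apply_symm hT]
    rw [inner_sub_right, inner_smul_right, Complex.sub_im, hreal, inner_self_eq_norm_sq_to_K,
      zero_sub]
    simp [← Complex.ofReal_pow]
  have h2 := (Complex.abs_im_le_norm _).trans
    (norm_inner_le_norm (𝕜 := ℂ) (x : K) (T x - z • (x : K)))
  rw [h1, abs_neg, abs_mul, abs_of_nonneg (sq_nonneg ‖(x : K)‖)] at h2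
  rcases (norm_nonneg (x : K)).eq_or_lt with h | h
  · rw [← h, mul_zero]; positivity
  · nlinarith

/-- The nonreal numbers belong to the resolvent set of a self-adjoint operator. -/
lemma exists_isResolventAt {T : K →ₗ.[ℂ] K} (hT : IsSelfAdjoint T) {z : ℂ} (hz : z.im ≠ 0) :
    ∃ R : K →L[ℂ] K, IsResolventAt T z R := by
  have hz' : 0 < |z.im| := abs_pos.2 hz
  have hcomplete : CompleteSpace T.graph :=
    (hT.isClosed : IsClosed (T.graph : Set (K × K))).completeSpace_coe
  let F : T.graph →L[ℂ] K :=
    (ContinuousLinearMap.snd ℂ K K - z • ContinuousLinearMap.fst ℂ K K).comp T.graph.subtypeL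
  have hFval : ∀ x : T.domain, F ⟨(x, T x), T.mem_graph x⟩ = T x - z • (x : K) := fun x => rfl
  have hcases : ∀ g : T.graph, ∃ x : T.domain, g = ⟨(x, T x), T.mem_graph x⟩ := by
    rintro ⟨⟨f, h⟩, hg⟩
    obtain ⟨y, rfl, rfl⟩ := (LinearPMap.mem_graph_iff T).1 hg
    exact ⟨y, rfl⟩
  -- The constant comes from `‖x‖ ≤ ‖F g‖ / |Im z|` and `‖T x‖ ≤ ‖F g‖ + ‖z‖ ‖x‖`. Being bounded
  -- below on a complete graph, `F` has closed range.
  have hbound : ∀ g : T.graph, ‖g‖ ≤ ((1 + (1 + ‖z‖) / |z.im|).toNNReal : ℝ) * ‖F g‖ := by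
    intro g
    obtain ⟨x, rfl⟩ := hcases g
    rw [hFval, Real.coe_toNNReal _ (by positivity)]
    have h1 := abs_im_mul_norm_le hT z x
    have h2 : ‖(x : K)‖ ≤ ‖T x - z • (x : K)‖ / |z.im| := by rwa [le_div_iff₀' hz']
    have h3 : ‖T x‖ ≤ ‖T x - z • (x : K)‖ + ‖z‖ * ‖(x : K)‖ := by
      rw [← norm_smul]
      simpa using norm_add_le (T x - z • (x : K)) (z • (x : K))
    have h4 : ‖z‖ * ‖(x : K)‖ ≤ ‖z‖ * (‖T x - z • (x : K)‖ / |z.im|) := by gcongr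
    have h5 : (1 + (1 + ‖z‖) / |z.im|) * ‖T x - z • (x : K)‖ = ‖T x - z • (x : K)‖ +
      ‖T x - z • (x : K)‖ / |z.im| + ‖z‖ * (‖T x - z • (x : K)‖ / |z.im|) := by ring
    have h6 : 0 ≤ ‖z‖ * (‖T x - z • (x : K)‖ / |z.im|) := by positivity
    have h7 : 0 ≤ ‖T x - z • (x : K)‖ / |z.im| := by positivity
    rw [h5]
    change max ‖(x : K)‖ ‖T x‖ ≤ _
    refine max_le ?_ ?_ <;> linarith [norm_nonneg (T x - z • (x : K))]
  have hanti := F.antilipschitz_of_bound hbound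
  have hclosed : IsClosed (LinearMap.range F.toLinearMap : Set K) :=
    hanti.isClosed_range F.uniformContinuous
  have hsurj : LinearMap.range F.toLinearMap = ⊤ := by
    rw [← hclosed.submodule_topologicalClosure_eq, Submodule.topologicalClosure_eq_top_iff,
      Submodule.eq_bot_iff]
    intro y hy
    -- A vector orthogonal to the range is an eigenvector for `conj z`, which the lower bound at
    -- `conj z` excludes unless it is zero.
    have h1 : (y, conj z • y) ∈ T.graph := mem_graph_of_forall_inner hT fun f => by
      have : inner ℂ (T f - z • (f : K)) y = 0 :=
        (Submodule.mem_orthogonal _ _).1 hy _ ⟨⟨(f, T f), T.mem_graph f⟩, rfl⟩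
      rw [← inner_conj_symm, map_eq_zero, inner_sub_right, sub_eq_zero, inner_smul_right] at this
      rw [this, inner_smul_left, Complex.conj_conj]
    obtain ⟨f, rfl, hf⟩ := (LinearPMap.mem_graph_iff T).1 h1
    have := abs_im_mul_norm_le hT (conj z) f
    dsimp only at hf
    rw [hf, sub_self, norm_zero, Complex.conj_im, abs_neg] at this
    have h2 : ‖(f : K)‖ ≤ 0 := by
      by_contra! h
      nlinarith [mul_pos hz' h]
    exact norm_le_zero_iff.1 h2
  let e := ContinuousLinearEquiv.ofBijective F (LinearMap.ker_eq_bot.2 hanti.injective) hsurj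
  refine ⟨(ContinuousLinearMap.fst ℂ K K).comp (T.graph.subtypeL.comp e.symm.toContinuousLinearMap),
    fun f => ?_, fun g => ?_⟩
  · have : e.symm (T f - z • (f : K)) = ⟨(f, T f), T.mem_graph f⟩ := by
      rw [ContinuousLinearEquiv.symm_apply_eq]
      rfl
    simp [this]
  · obtain ⟨x, hx⟩ := hcases (e.symm g)
    have h1 : ((e.symm g : T.graph) : K × K).1 = x := by rw [hx]
    refine ⟨by simp [h1], ?_⟩
    have h2 : e (e.symm g) = g := e.apply_symm_apply g
    rw [hx] at h2
    simp only [ContinuousLinearMap.comp_apply, ContinuousLinearEquiv.coe_coe,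
      Submodule.subtypeL_apply, ContinuousLinearMap.coe_fst', h1]
    exact h2

end Resolvent

/-! ### The Cayley transform is unitary. -/

section Spectral

variable {K : Type*} [NormedAddCommGroup K] [InnerProductSpace ℂ K] [CompleteSpace K]

lemma isResolventAt_resolventOp {T : K →ₗ.[ℂ] K} (hT : IsSelfAdjoint T) {z : ℂ} (hz : z.im ≠ 0) :
    IsResolventAt T z (resolventOp T z) := by
  have h := exists_isResolventAt hT hz
  rw [resolventOp, dif_pos h]
  exact h.choose_spec

lemma cayley_apply {T : K →ₗ.[ℂ] K} (hT : IsSelfAdjoint T) (x : T.domain) :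
    cayley T (T x + Complex.I • (x : K)) = T x - Complex.I • (x : K) := by
  have h := (isResolventAt_resolventOp hT (z := -Complex.I) (by simp)).1 x
  rw [neg_smul, sub_neg_eq_add] at h
  simp only [cayley, sub_apply, one_apply_eq_self,
    smul_apply, h]
  module

lemma exists_eq_apply_add {T : K →ₗ.[ℂ] K} (hT : IsSelfAdjoint T) (y : K) :
    ∃ x : T.domain, y = T x + Complex.I • (x : K) := by
  obtain ⟨h, h'⟩ := (isResolventAt_resolventOp hT (z := -Complex.I) (by simp)).2 y
  exact ⟨⟨_, h⟩, by rw [← sub_neg_eq_add, ← neg_smul]; exact h'.symm⟩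

lemma exists_eq_apply_sub {T : K →ₗ.[ℂ] K} (hT : IsSelfAdjoint T) (y : K) :
    ∃ x : T.domain, y = T x - Complex.I • (x : K) := by
  obtain ⟨h, h'⟩ := (isResolventAt_resolventOp hT (z := Complex.I) (by simp)).2 y
  exact ⟨⟨_, h⟩, h'.symm⟩

lemma norm_apply_add_eq {T : K →ₗ.[ℂ] K} (hT : IsSelfAdjoint T) (x : T.domain) :
    ‖T x - Complex.I • (x : K)‖ = ‖T x + Complex.I • (x : K)‖ := by
  rw [← sq_eq_sq₀ (norm_nonneg _) (norm_nonneg _), norm_sub_sq (𝕜 := ℂ), norm_add_sq (𝕜 := ℂ)]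
  have hreal : (inner ℂ (x : K) (T x)).im = 0 := by
    rw [← Complex.conj_eq_iff_im, inner_conj_symm, inner_apply_symm hT]
  have : RCLike.re (inner ℂ (T x) (Complex.I • (x : K))) = 0 := by
    rw [inner_smul_right, inner_apply_symm hT]
    simp [hreal]
  rw [this]
  ring

lemma cayley_mem_unitary {T : K →ₗ.[ℂ] K} (hT : IsSelfAdjoint T) :
    cayley T ∈ unitary (K →L[ℂ] K) := by
  have hnorm : ∀ y, ‖cayley T y‖ = ‖y‖ := fun y => by
    obtain ⟨x, rfl⟩ := exists_eq_apply_add hT y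
    rw [cayley_apply hT, norm_apply_add_eq hT]
  have hsurj : Function.Surjective (cayley T) := fun y => by
    obtain ⟨x, rfl⟩ := exists_eq_apply_sub hT y
    exact ⟨_, cayley_apply hT x⟩
  have h1 : star (cayley T) * cayley T = 1 :=
    (ContinuousLinearMap.norm_map_iff_adjoint_comp_self _).1 hnorm
  refine Unitary.mem_iff.2 ⟨h1, ?_⟩
  ext y
  obtain ⟨x, rfl⟩ := hsurj y
  have := congrArg (fun S : K →L[ℂ] K => S x) h1
  simp only [mul_apply_eq_comp, one_apply_eq_self] at this ⊢
  rw [this]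

end Spectral

/-! ### Nonnegativity off the negative spectral subspace. -/

section NegativePart

variable {K : Type*} [NormedAddCommGroup K] [InnerProductSpace ℂ K] [CompleteSpace K]

/-- Continuous functions supported in the negative half line that are transformed by the Cayley map
into truncations of the positive part of the imaginary part. -/
noncomputable def negBump (e t : ℝ) : ℝ := max (-2 * t / (t ^ 2 + 1) - e) 0

lemma negBump_continuous (e : ℝ) : Continuous (negBump e) := by
  unfold negBump
  have : ∀ t : ℝ, t ^ 2 + 1 ≠ 0 := fun t => by positivity
  fun_prop (disch := exact this _)

lemma negBump_support {e : ℝ} (he : 0 < e) :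
    Function.support (negBump e) ⊆ Set.Icc (-(2 / e)) (-(e / 2)) := by
  intro t ht
  have h1 : 0 < -2 * t / (t ^ 2 + 1) - e := by
    by_contra! h
    exact ht (max_eq_right h)
  have h2 : e * (t ^ 2 + 1) < -2 * t := by
    rw [sub_pos, lt_div_iff₀ (by positivity)] at h1
    exact h1
  have h3 : t < -(e / 2) := by nlinarith [mul_nonneg he.le (sq_nonneg t)]
  refine ⟨?_, h3.le⟩
  rw [neg_le, le_div_iff₀ he]
  by_contra! h
  nlinarith

lemma negBump_mem {e : ℝ} (he : 0 < e) :
    Continuous (negBump e) ∧ HasCompactSupport (negBump e) ∧ tsupport (negBump e) ⊆ Set.Iio 0 := by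
  refine ⟨negBump_continuous e,
    HasCompactSupport.of_support_subset_isCompact isCompact_Icc (negBump_support he), ?_⟩
  refine (closure_minimal (negBump_support he) isClosed_Icc).trans fun t ht => ?_
  have : 0 < e / 2 := by positivity
  exact lt_of_le_of_lt ht.2 (by linarith)

/-- The Cayley map sends `t` to `w` with `Im w = -2t / (t² + 1)`, so the negative half line becomes
the open upper half circle. -/
lemma negBump_cayley (e : ℝ) {w : ℂ} (hw : ‖w‖ = 1) (h : w ≠ 1) :
    negBump e (Complex.I * (1 + w) / (1 - w)).re = max (w.im - e) 0 := by
  have hsq : w.re ^ 2 + w.im ^ 2 = 1 := by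
    have := Complex.normSq_eq_norm_sq w
    rw [hw, Complex.normSq_apply] at this
    linarith
  have hre : 1 - w.re ≠ 0 := fun hre => h (by
    apply Complex.ext
    · simp; linarith
    · simp; nlinarith)
  have ht : (Complex.I * (1 + w) / (1 - w)).re = -w.im / (1 - w.re) := by
    rw [Complex.div_re, Complex.normSq_apply]
    have hd : (1 - w).re * (1 - w).re + (1 - w).im * (1 - w).im = 2 * (1 - w.re) := by
      simp; nlinarith
    rw [hd]
    simp
    field_simp
    ring
  rw [ht, negBump]
  congr 2
  have hd : (-w.im / (1 - w.re)) ^ 2 + 1 = 2 / (1 - w.re) := by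
    field_simp
    nlinarith
  rw [hd]
  field_simp

lemma norm_eq_one_of_mem_spectrum {T : K →ₗ.[ℂ] K} (hT : IsSelfAdjoint T) {w : ℂ}
    (hw : w ∈ spectrum ℂ (cayley T)) : ‖w‖ = 1 := by
  have h := cayley_mem_unitary hT
  generalize cayley T = U at h hw
  have := spectrum.subset_circle_of_unitary (𝕜 := ℂ) h
  exact mem_sphere_zero_iff_norm.1 (this hw)

lemma funCalc_negBump {T : K →ₗ.[ℂ] K} (hT : IsSelfAdjoint T) {e : ℝ} (he : 0 < e) :
    funCalc T (negBump e) = cfc (fun w : ℂ => ((max (w.im - e) 0 : ℝ) : ℂ)) (cayley T) := by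
  unfold funCalc
  refine cfc_congr fun w hw => ?_
  split_ifs with h
  · rw [h, max_eq_right (by simpa using he.le), Complex.ofReal_zero]
  · rw [negBump_cayley e (norm_eq_one_of_mem_spectrum hT hw) h]

lemma cfc_re_im_decomp (U : K →L[ℂ] K) [IsStarNormal U] :
    U = cfc (fun w : ℂ => (w.re : ℂ)) U +
      Complex.I • cfc (fun w : ℂ => ((max w.im 0 : ℝ) : ℂ)) U -
      Complex.I • cfc (fun w : ℂ => ((max w.im 0 - w.im : ℝ) : ℂ)) U := by
  have h1 : Continuous fun w : ℂ => (w.re : ℂ) := by fun_prop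
  have h2 : Continuous fun w : ℂ => ((max w.im 0 : ℝ) : ℂ) := by fun_prop
  have h3 : Continuous fun w : ℂ => ((max w.im 0 - w.im : ℝ) : ℂ) := by fun_prop
  have h4 : Continuous fun w : ℂ => Complex.I • ((max w.im 0 : ℝ) : ℂ) := by fun_prop
  have h5 : Continuous fun w : ℂ => Complex.I • ((max w.im 0 - w.im : ℝ) : ℂ) := by fun_prop
  rw [← cfc_smul Complex.I _ U h2.continuousOn, ← cfc_smul Complex.I _ U h3.continuousOn,
    ← cfc_add U _ _ h1.continuousOn h4.continuousOn,
    ← cfc_sub (fun w : ℂ => (w.re : ℂ) + Complex.I • ((max w.im 0 : ℝ) : ℂ)) _ U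
      (h1.add h4).continuousOn h5.continuousOn]
  conv_lhs => rw [← cfc_id ℂ U]
  congr 1
  funext w
  apply Complex.ext <;> simp

/-- A self-adjoint operator is nonnegative on the orthogonal complement of its negative spectral
subspace. -/
lemma re_inner_nonneg_of_orthogonal {T : K →ₗ.[ℂ] K} (hT : IsSelfAdjoint T) (x : T.domain)
    (hx : ∀ n ∈ ranSpectralProj T (Set.Iio 0), inner ℂ n (x : K) = 0) :
    0 ≤ (inner ℂ (T x) (x : K)).re := by
  set U := cayley T with hU
  have hUu := cayley_mem_unitary hT
  have hUn : IsStarNormal U := ⟨by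
    rw [Commute, SemiconjBy, Unitary.star_mul_self_of_mem hUu, Unitary.mul_star_self_of_mem hUu]⟩
  have hnull : ∀ e > 0, cfc (fun w : ℂ => ((max (w.im - e) 0 : ℝ) : ℂ)) U (x : K) = 0 := by
    intro e he
    have hsa : IsSelfAdjoint (cfc (fun w : ℂ => ((max (w.im - e) 0 : ℝ) : ℂ)) U) := by
      rw [isSelfAdjoint_iff, ← cfc_star]
      simp
    rw [← inner_self_eq_zero (𝕜 := ℂ)]
    rw [ContinuousLinearMap.isSelfAdjoint_iff'] at hsa
    nth_rewrite 2 [← hsa]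
    rw [ContinuousLinearMap.adjoint_inner_right, ← funCalc_negBump hT he]
    refine hx _ (Submodule.le_topologicalClosure _ ?_)
    exact (le_iSup₂ (f := fun (φ : ℝ → ℝ)
      (_ : φ ∈ {φ : ℝ → ℝ | Continuous φ ∧ HasCompactSupport φ ∧ tsupport φ ⊆ Set.Iio 0}) =>
        LinearMap.range (funCalc T φ).toLinearMap) (negBump e) (negBump_mem he)) ⟨_, rfl⟩
  set P := cfc (fun w : ℂ => ((max w.im 0 : ℝ) : ℂ)) U with hP
  have hPx : P (x : K) = 0 := by
    -- The truncations annihilate `x` and converge in norm to `P`, the positive part of the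
    -- imaginary part of `U`.
    have : ∀ e > 0, ‖P (x : K)‖ ≤ e * ‖(x : K)‖ := by
      intro e he
      have h1 : ‖P - cfc (fun w : ℂ => ((max (w.im - e) 0 : ℝ) : ℂ)) U‖ ≤ e := by
        rw [hP, ← cfc_sub _ _ U]
        refine norm_cfc_le he.le fun w _ => ?_
        rw [← Complex.ofReal_sub, Complex.norm_real, Real.norm_eq_abs]
        refine (abs_max_sub_max_le_abs _ _ _).trans ?_
        rw [sub_sub_cancel, abs_of_pos he]
      have h2 := (P - cfc (fun w : ℂ => ((max (w.im - e) 0 : ℝ) : ℂ)) U).le_of_opNorm_le h1 (x : K)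
      rwa [sub_apply, hnull e he, sub_zero] at h2
    have h0 : ‖P (x : K)‖ ≤ 0 := by
      refine le_of_forall_pos_le_add fun d hd => ?_
      have := this (d / (‖(x : K)‖ + 1)) (by positivity)
      rw [zero_add]
      refine this.trans ?_
      rw [div_mul_eq_mul_div, div_le_iff₀ (by positivity)]
      nlinarith
    exact norm_le_zero_iff.1 h0
  set y := T x + Complex.I • (x : K) with hy
  have hUy : U y = T x - Complex.I • (x : K) := cayley_apply hT x
  have hPy : P y = 0 := by
    have hcomm : Commute P U := by
      have := cfc_commute_cfc (fun w : ℂ => ((max w.im 0 : ℝ) : ℂ)) id U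
      rwa [cfc_id ℂ U] at this
    -- As `y - U y = 2i x` and `P x = 0`, the vector `P y` is fixed by `U`; a Cayley transform has
    -- no nonzero fixed vector.
    have h1 : U (P y) = P y := by
      have h2 : y - U y = (2 * Complex.I) • (x : K) := by rw [hUy, hy]; module
      have h3 : P (y - U y) = 0 := by rw [h2, map_smul, hPx, smul_zero]
      have h4 : P (U y) = U (P y) := congrArg (fun S : K →L[ℂ] K => S y) hcomm.eq
      rw [map_sub, sub_eq_zero, h4] at h3
      exact h3.symm
    obtain ⟨f, hf⟩ := exists_eq_apply_add hT (P y)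
    rw [hf, hU, cayley_apply hT] at h1
    have h2 : (2 * Complex.I) • (f : K) = 0 := by
      have := sub_eq_zero.2 h1.symm
      rw [← this]; module
    have h3 : (f : K) = 0 := by simpa using h2
    have h4 : f = 0 := Subtype.ext h3
    rw [hf, h4, LinearPMap.map_zero]
    simp
  have hneg : 0 ≤ cfc (fun w : ℂ => ((max w.im 0 - w.im : ℝ) : ℂ)) U :=
    cfc_nonneg fun w _ => by
      rw [Complex.zero_le_real]
      linarith [le_max_left w.im 0]
  have hUdecomp : U = cfc (fun w : ℂ => (w.re : ℂ)) U + Complex.I • P -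
      Complex.I • cfc (fun w : ℂ => ((max w.im 0 - w.im : ℝ) : ℂ)) U := cfc_re_im_decomp U
  have hresa : (inner ℂ (cfc (fun w : ℂ => (w.re : ℂ)) U y) y).im = 0 := by
    have hsa : IsSelfAdjoint (cfc (fun w : ℂ => (w.re : ℂ)) U) := by
      rw [isSelfAdjoint_iff, ← cfc_star]
      simp
    rw [ContinuousLinearMap.isSelfAdjoint_iff'] at hsa
    rw [← Complex.conj_eq_iff_im, inner_conj_symm]
    nth_rewrite 1 [← hsa]
    rw [ContinuousLinearMap.adjoint_inner_right]
  -- With `P y = 0`, the imaginary part comes only from `-i` times a nonnegative operator, and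
  -- conjugate linearity in the first slot turns `-i` into `i`.
  have himneg : 0 ≤ (inner ℂ (U y) y).im := by
    have h1 := ((ContinuousLinearMap.nonneg_iff_isPositive _).1 hneg).re_inner_nonneg_left y
    rw [hUdecomp]
    simp only [sub_apply, add_apply, smul_apply, hPy, smul_zero, add_zero, inner_sub_left,
      inner_smul_left, Complex.sub_im, hresa]
    simpa using h1
  have h1 : (inner ℂ (U y) y).im = 2 * (inner ℂ (T x) (x : K)).re := by
    have hreal : (inner ℂ (T x) (x : K)).im = 0 := by
      rw [← Complex.conj_eq_iff_im, inner_conj_symm, inner_apply_symm hT]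
    have h2 : inner ℂ (x : K) (T x) = inner ℂ (T x) (x : K) := (inner_apply_symm hT x x).symm
    rw [hUy, hy]
    simp only [inner_sub_left, inner_add_right, inner_smul_left, inner_smul_right, h2]
    simp [← Complex.ofReal_pow]
    ring
  linarith

lemma finiteDimensional_of_kappaMinus {T : K →ₗ.[ℂ] K} (h : kappaMinus T < Cardinal.aleph0) :
    FiniteDimensional ℂ (ranSpectralProj T (Set.Iio 0)) :=
  Module.rank_lt_aleph0_iff.1 h

end NegativePart

/-! ### Graphs of products, sums and closures. -/

section Graph

variable {K : Type*} [NormedAddCommGroup K] [InnerProductSpace ℂ K]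

lemma mem_mulMax_graph {S T : K →ₗ.[ℂ] K} {f h : K} :
    (f, h) ∈ (mulMax S T).graph ↔ ∃ g, (f, g) ∈ T.graph ∧ (g, h) ∈ S.graph := by
  constructor
  · intro hf
    obtain ⟨⟨x, hx⟩, rfl, rfl⟩ := (LinearPMap.mem_graph_iff _).1 hf
    obtain ⟨h1, h2⟩ := mem_mulMax_domain.1 hx
    exact ⟨_, T.mem_graph ⟨x, h1⟩, S.mem_graph ⟨_, h2⟩⟩
  · rintro ⟨g, hg, hh⟩
    obtain ⟨x, rfl, rfl⟩ := (LinearPMap.mem_graph_iff _).1 hg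
    obtain ⟨y, hy, rfl⟩ := (LinearPMap.mem_graph_iff _).1 hh
    dsimp only at hy
    have hd : T x ∈ S.domain := hy ▸ y.2
    obtain rfl : y = ⟨T x, hd⟩ := Subtype.ext hy
    exact (mulMax S T).mem_graph ⟨x, mem_mulMax_domain.2 ⟨x.2, hd⟩⟩

lemma mem_vadd_graph {M : K →ₗ[ℂ] K} {T : K →ₗ.[ℂ] K} {f h : K} :
    (f, h) ∈ (M +ᵥ T).graph ↔ (f, h - M f) ∈ T.graph := by
  simp only [LinearPMap.mem_graph_iff]
  constructor
  · rintro ⟨y, rfl, rfl⟩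
    exact ⟨y, rfl, by simp [LinearPMap.vadd_apply]⟩
  · rintro ⟨y, hy, hy'⟩
    exact ⟨y, hy, by rw [LinearPMap.vadd_apply, hy', ← hy, add_sub_cancel]⟩

lemma mem_addScalar_graph {T : K →ₗ.[ℂ] K} {w : ℂ} {f h : K} :
    (f, h) ∈ (addScalar T w).graph ↔ (f, h - w • f) ∈ T.graph :=
  mem_vadd_graph

lemma mem_sub_graph {S T : K →ₗ.[ℂ] K} {f h : K} :
    (f, h) ∈ (S - T).graph ↔ ∃ g k, (f, g) ∈ S.graph ∧ (f, k) ∈ T.graph ∧ h = g - k := by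
  constructor
  · intro hf
    obtain ⟨⟨x, hx⟩, rfl, rfl⟩ := (LinearPMap.mem_graph_iff _).1 hf
    exact ⟨_, _, S.mem_graph ⟨x, hx.1⟩, T.mem_graph ⟨x, hx.2⟩, rfl⟩
  · rintro ⟨g, k, hg, hk, rfl⟩
    obtain ⟨x, rfl, rfl⟩ := (LinearPMap.mem_graph_iff _).1 hg
    obtain ⟨y, hy, rfl⟩ := (LinearPMap.mem_graph_iff _).1 hk
    dsimp only at hy
    have hd : (x : K) ∈ T.domain := hy ▸ y.2
    obtain rfl : y = ⟨x, hd⟩ := Subtype.ext hy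
    exact (S - T).mem_graph ⟨x, x.2, hd⟩

lemma mem_compPMap_graph {M N : K →L[ℂ] K} (hMN : ∀ x, M (N x) = x) (hNM : ∀ x, N (M x) = x)
    {T : K →ₗ.[ℂ] K} {f h : K} :
    (f, h) ∈ (M.toLinearMap.compPMap T).graph ↔ (f, N h) ∈ T.graph := by
  simp only [LinearPMap.mem_graph_iff]
  constructor
  · rintro ⟨y, rfl, rfl⟩
    exact ⟨y, rfl, (hNM _).symm⟩
  · rintro ⟨y, hy, hy'⟩
    exact ⟨y, hy, (congrArg M hy').trans (hMN h)⟩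

lemma graph_zero_right {T : K →ₗ.[ℂ] K} {h : K} (hh : ((0 : K), h) ∈ T.graph) : h = 0 :=
  T.graph_fst_eq_zero_snd hh rfl

lemma closure_eq_of_graph {T F : K →ₗ.[ℂ] K} (h : T.graph.topologicalClosure = F.graph) :
    T.IsClosable ∧ T.closure = F := by
  have hT : T.IsClosable := ⟨F, h⟩
  exact ⟨hT, LinearPMap.eq_of_eq_graph (hT.graph_closure_eq_closure_graph.symm.trans h)⟩

lemma isSelfAdjoint_of_maximal [CompleteSpace K] {T : K →ₗ.[ℂ] K}
    (hd : Dense (T.domain : Set K))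
    (hs : ∀ x y : T.domain, inner ℂ (T x) (y : K) = inner ℂ (x : K) (T y))
    (hmax : ∀ x y : K, (∀ f : T.domain, inner ℂ y (f : K) = inner ℂ x (T f)) → (x, y) ∈ T.graph) :
    IsSelfAdjoint T := by
  rw [LinearPMap.isSelfAdjoint_def]
  refine le_antisymm ?_ (LinearPMap.IsFormalAdjoint.le_adjoint hd hs)
  refine LinearPMap.le_of_le_graph ?_
  rintro ⟨x, y⟩ hxy
  obtain ⟨z, rfl, rfl⟩ := (LinearPMap.mem_graph_iff _).1 hxy
  exact hmax _ _ fun f => LinearPMap.adjoint_isFormalAdjoint hd z f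

end Graph

/-! ### The Schur complement factorization. -/

section Schur

variable {H : Type*} [NormedAddCommGroup H] [InnerProductSpace ℂ H]
  {A B C : H →ₗ.[ℂ] H} {R G : H →L[ℂ] H}

open ContinuousLinearMap (adjoint)

lemma J_fst (f : WithLp 2 (H × H)) : (J H f).fst = Complex.I • f.snd := rfl

lemma J_snd (f : WithLp 2 (H × H)) : (J H f).snd = -Complex.I • f.fst := rfl

lemma J_J (f : WithLp 2 (H × H)) : J H (J H f) = f := by
  refine (WithLp.ofLp_injective 2) (Prod.ext ?_ ?_)
  · change Complex.I • (-Complex.I • f.fst) = f.fst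
    rw [smul_smul]; simp
  · change -Complex.I • (Complex.I • f.snd) = f.snd
    rw [smul_smul]; simp

lemma inner_J (f g : WithLp 2 (H × H)) : inner ℂ (J H f) g = inner ℂ f (J H g) := by
  simp only [WithLp.prod_inner_apply]
  change inner ℂ (Complex.I • f.snd) g.fst + inner ℂ (-Complex.I • f.fst) g.snd =
    inner ℂ f.fst (Complex.I • g.snd) + inner ℂ f.snd (-Complex.I • g.fst)
  simp only [inner_smul_left, inner_smul_right, map_neg, Complex.conj_I]
  ring

lemma mem_graph_iff_resolvent (hR : IsResolventAt A 0 R) {f h : H} :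
    (f, h) ∈ A.graph ↔ R h = f := by
  simpa using isResolventAt_iff.1 hR f h

lemma mem_inverse_graph_iff (hR : IsResolventAt A 0 R) {f h : H} :
    (f, h) ∈ A.inverse.graph ↔ R f = h := by
  have hker : LinearMap.ker A.toFun = ⊥ := by
    rw [LinearMap.ker_eq_bot']
    intro x hx
    have := (mem_graph_iff_resolvent hR).1 (A.mem_graph x)
    have hx' : A x = 0 := hx
    rw [hx', map_zero] at this
    exact Subtype.ext this.symm
  rw [LinearPMap.inverse_graph hker, ← mem_graph_iff_resolvent hR, Submodule.mem_map]
  constructor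
  · rintro ⟨⟨x, y⟩, hp, he⟩
    obtain ⟨rfl, rfl⟩ := Prod.ext_iff.1 he
    exact hp
  · intro hp
    exact ⟨(h, f), hp, rfl⟩

variable [CompleteSpace H]

/-- The bounded operator `C A⁻¹`. -/
lemma exists_mul_resolvent (hR : IsResolventAt A 0 R) (hC : C.IsClosed)
    (hAC : A.domain ≤ C.domain) : ∃ G : H →L[ℂ] H, ∀ g h, (R g, h) ∈ C.graph ↔ h = G g := by
  have hdom : ∀ g, R g ∈ C.domain := fun g => hAC (hR.2 g).1
  let G₀ : H →ₗ[ℂ] H :=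
    C.toFun ∘ₗ LinearMap.codRestrict C.domain R.toLinearMap hdom
  have hG₀ : ∀ g h, (R g, h) ∈ C.graph ↔ h = G₀ g := by
    intro g h
    have h1 : (R g, G₀ g) ∈ C.graph := C.mem_graph ⟨R g, hdom g⟩
    exact ⟨fun h2 => C.mem_graph_snd_inj h2 h1 rfl, fun h2 => h2 ▸ h1⟩
  have hcl : IsClosed (G₀.graph : Set (H × H)) := by
    have : (G₀.graph : Set (H × H)) = (fun p : H × H => (R p.1, p.2)) ⁻¹' C.graph := by
      ext ⟨g, h⟩
      simp [LinearMap.mem_graph_iff, hG₀]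
    rw [this]
    exact hC.preimage (by fun_prop)
  exact ⟨⟨G₀, G₀.continuous_of_isClosed_graph hcl⟩, hG₀⟩

lemma resolvent_symm (hA : IsSelfAdjoint A) (hR : IsResolventAt A 0 R) (x y : H) :
    inner ℂ (R x) y = inner ℂ x (R y) := by
  obtain ⟨f, hf, rfl⟩ := (LinearPMap.mem_graph_iff _).1
    ((mem_graph_iff_resolvent hR).2 (rfl : R x = _))
  obtain ⟨g, hg, rfl⟩ := (LinearPMap.mem_graph_iff _).1
    ((mem_graph_iff_resolvent hR).2 (rfl : R y = _))
  dsimp only at hf hg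
  rw [← hf, ← hg, inner_apply_symm hA]

/-- `(C A⁻¹)*` extends `A⁻¹ C*`, because `A⁻¹` is symmetric. -/
lemma adjoint_eq_of_mem_graph (hA : IsSelfAdjoint A) (hR : IsResolventAt A 0 R)
    (hAC : A.domain ≤ C.domain) (hG : ∀ g h, (R g, h) ∈ C.graph ↔ h = G g) {f k : H}
    (hf : (f, k) ∈ C†.graph) : adjoint G f = R k := by
  have hd : Dense (C.domain : Set H) := hA.dense_domain.mono hAC
  obtain ⟨y, rfl, rfl⟩ := (LinearPMap.mem_graph_iff _).1 hf
  refine ext_inner_right ℂ fun v => ?_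
  obtain ⟨x, hx, hx'⟩ := (LinearPMap.mem_graph_iff _).1 ((hG v _).2 rfl)
  dsimp only at hx hx' ⊢
  rw [ContinuousLinearMap.adjoint_inner_left, resolvent_symm hA hR, ← hx, ← hx']
  exact (LinearPMap.adjoint_isFormalAdjoint hd y x).symm

lemma mem_S0_graph (hR : IsResolventAt A 0 R) (hG : ∀ g h, (R g, h) ∈ C.graph ↔ h = G g)
    {f h : H} : (f, h) ∈ (S0 A B C).graph ↔
      ∃ b k, (f, b) ∈ B.graph ∧ (f, k) ∈ C†.graph ∧ h = b - G k := by
  rw [S0, mem_sub_graph]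
  constructor
  · rintro ⟨b, l, hb, hl, rfl⟩
    obtain ⟨g, hg, hgl⟩ := mem_mulMax_graph.1 hl
    obtain ⟨k, hk, hkg⟩ := mem_mulMax_graph.1 hg
    obtain rfl := (mem_inverse_graph_iff hR).1 hkg
    exact ⟨b, k, hb, hk, by rw [(hG _ _).1 hgl]⟩
  · rintro ⟨b, k, hb, hk, rfl⟩
    exact ⟨b, G k, hb, mem_mulMax_graph.2 ⟨R k, mem_mulMax_graph.2 ⟨k, hk,
      (mem_inverse_graph_iff hR).2 rfl⟩, (hG _ _).2 rfl⟩, rfl⟩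

/-- The bounded operator `T(z) - S₀`. -/
noncomputable def schurPerturbation (R G : H →L[ℂ] H) (z : ℂ) : H →L[ℂ] H :=
  (Complex.I * z) • G - (Complex.I * z) • adjoint G - (z * z) • R

/-- Expanding the product and replacing `A⁻¹ C*` by `G*` turns all `z`-dependent terms into bounded
operators. -/
lemma mem_T_graph (hA : IsSelfAdjoint A) (hR : IsResolventAt A 0 R) (hAC : A.domain ≤ C.domain)
    (hG : ∀ g h, (R g, h) ∈ C.graph ↔ h = G g) {z : ℂ} {f h : H} :
    (f, h) ∈ (T A B C z).graph ↔ (f, h - schurPerturbation R G z f) ∈ (S0 A B C).graph := by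
  have hI : Complex.I * Complex.I = -1 := Complex.I_mul_I
  have hM : schurPerturbation R G z f = (Complex.I * z) • G f - (Complex.I * z) • adjoint G f -
    (z * z) • R f := rfl
  rw [T, mem_sub_graph, mem_S0_graph hR hG]
  constructor
  · rintro ⟨b, l, hb, hl, rfl⟩
    obtain ⟨g, hg, hgl⟩ := mem_mulMax_graph.1 hl
    obtain ⟨k, hk, hkg⟩ := mem_mulMax_graph.1 hg
    obtain rfl := (mem_inverse_graph_iff hR).1 hkg
    rw [mem_addScalar_graph] at hk hgl
    refine ⟨b, _, hb, hk, ?_⟩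
    have h1 := eq_add_of_sub_eq ((hG _ _).1 hgl)
    rw [h1, hM, adjoint_eq_of_mem_graph hA hR hAC hG hk]
    simp only [map_smul, neg_smul, sub_neg_eq_add, map_add, smul_add, smul_smul]
    rw [show Complex.I * z * (Complex.I * z) = -(z * z) by linear_combination (z * z) * hI]
    module
  · rintro ⟨b, k, hb, hk, hh⟩
    refine ⟨b, G (k - (Complex.I * z) • f) + (Complex.I * z) • R (k - (Complex.I * z) • f), hb,
      mem_mulMax_graph.2 ⟨R (k - (Complex.I * z) • f), mem_mulMax_graph.2 ⟨k - (Complex.I * z) • f,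
        mem_addScalar_graph.2 ?_, (mem_inverse_graph_iff hR).2 rfl⟩, mem_addScalar_graph.2 ?_⟩, ?_⟩
    · rwa [neg_smul, sub_neg_eq_add, sub_add_cancel]
    · rw [add_sub_cancel_right, hG]
    · rw [eq_add_of_sub_eq hh, hM, adjoint_eq_of_mem_graph hA hR hAC hG hk]
      simp only [map_sub, map_smul, smul_sub, smul_smul]
      rw [show Complex.I * z * (Complex.I * z) = -(z * z) by linear_combination (z * z) * hI]
      module

lemma mem_T_closure_graph (hA : IsSelfAdjoint A) (hR : IsResolventAt A 0 R)
    (hAC : A.domain ≤ C.domain) (hG : ∀ g h, (R g, h) ∈ C.graph ↔ h = G g)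
    (hS : (S0 A B C).IsClosable) {z : ℂ} {f h : H} :
    (f, h) ∈ (T A B C z).closure.graph ↔
      (f, h - schurPerturbation R G z f) ∈ (S0 A B C).closure.graph := by
  let M := schurPerturbation R G z
  -- Adding a bounded operator is a shear of the graph, and a homeomorphism commutes with closure.
  let e : H × H ≃ₜ H × H :=
    { toFun := fun p => (p.1, p.2 - M p.1)
      invFun := fun p => (p.1, p.2 + M p.1)
      left_inv := fun p => by simp
      right_inv := fun p => by simp
      continuous_toFun := by fun_prop
      continuous_invFun := by fun_prop }
  have hgraph : ((T A B C z).graph : Set (H × H)) = e ⁻¹' ((S0 A B C).graph : Set (H × H)) := by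
    ext ⟨f, h⟩
    exact mem_T_graph hA hR hAC hG
  have hcl : (T A B C z).graph.topologicalClosure =
      (M.toLinearMap +ᵥ (S0 A B C).closure).graph := by
    refine SetLike.coe_injective ?_
    rw [Submodule.topologicalClosure_coe, hgraph, ← e.preimage_closure,
      ← Submodule.topologicalClosure_coe, hS.graph_closure_eq_closure_graph]
    ext ⟨f, h⟩
    exact mem_vadd_graph.symm
  rw [(closure_eq_of_graph hcl).2]
  exact mem_vadd_graph

lemma mem_A0_graph (hA : IsSelfAdjoint A) (hR : IsResolventAt A 0 R) (hAC : A.domain ≤ C.domain)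
    (hG : ∀ g h, (R g, h) ∈ C.graph ↔ h = G g) {f h : WithLp 2 (H × H)} :
    (f, h) ∈ (A0 A B C).graph ↔ (f.fst + adjoint G f.snd, h.fst) ∈ A.graph ∧
      (f.snd, h.snd - G h.fst) ∈ (S0 A B C).graph := by
  rw [mem_graph_iff_resolvent hR, mem_S0_graph hR hG]
  constructor
  · intro hf
    obtain ⟨x, rfl, rfl⟩ := (LinearPMap.mem_graph_iff _).1 hf
    have h1 := A.mem_graph ⟨_, x.2.1.1⟩
    have h2 := (C†).mem_graph ⟨_, x.2.2.1⟩
    have h3 := C.mem_graph ⟨_, x.2.1.2⟩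
    have h4 := B.mem_graph ⟨_, x.2.2.2⟩
    have h5 := adjoint_eq_of_mem_graph hA hR hAC hG h2
    have h6 := (mem_graph_iff_resolvent hR).1 h1
    have h7 : C ⟨_, x.2.1.2⟩ = G (A ⟨_, x.2.1.1⟩) := by
      refine (hG _ _).1 ?_
      rw [h6]
      exact h3
    dsimp only at h5 h6
    refine ⟨?_, _, _, h4, h2, ?_⟩
    · change R (A ⟨_, x.2.1.1⟩ + C† ⟨_, x.2.2.1⟩) = _
      rw [map_add, h6]
      exact congrArg _ h5.symm
    · change C ⟨_, x.2.1.2⟩ + B ⟨_, x.2.2.2⟩ - G (A ⟨_, x.2.1.1⟩ + C† ⟨_, x.2.2.1⟩) = _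
      rw [map_add, h7]
      abel
  · rintro ⟨h1, b, k, hb, hk, h2⟩
    have h3 := adjoint_eq_of_mem_graph hA hR hAC hG hk
    have h4 : R (h.fst - k) = f.fst := by rw [map_sub, h1, h3, add_sub_cancel_right]
    have h5 := (mem_graph_iff_resolvent hR).2 h4
    have h6 : (f.fst, G (h.fst - k)) ∈ C.graph := by rw [← h4, hG]
    obtain ⟨a', ha, ha'⟩ := (LinearPMap.mem_graph_iff _).1 h5
    obtain ⟨c', hc, hc'⟩ := (LinearPMap.mem_graph_iff _).1 h6
    obtain ⟨b', hb1, hb'⟩ := (LinearPMap.mem_graph_iff _).1 hb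
    obtain ⟨k', hk1, hk'⟩ := (LinearPMap.mem_graph_iff _).1 hk
    dsimp only at ha ha' hc hc' hb1 hb' hk1 hk'
    have d1 : f.fst ∈ A.domain := ha ▸ a'.2
    have d2 : f.fst ∈ C.domain := hc ▸ c'.2
    have d3 : f.snd ∈ B.domain := hb1 ▸ b'.2
    have d4 : f.snd ∈ C†.domain := hk1 ▸ k'.2
    obtain rfl : a' = ⟨_, d1⟩ := Subtype.ext ha
    obtain rfl : c' = ⟨_, d2⟩ := Subtype.ext hc
    obtain rfl : b' = ⟨_, d3⟩ := Subtype.ext hb1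
    obtain rfl : k' = ⟨_, d4⟩ := Subtype.ext hk1
    refine (LinearPMap.mem_graph_iff _).2 ⟨⟨f, ⟨d1, d2⟩, ⟨d4, d3⟩⟩, rfl, ?_⟩
    refine (WithLp.ofLp_injective 2) (Prod.ext ?_ ?_)
    · change A ⟨_, d1⟩ + C† ⟨_, d4⟩ = h.fst
      rw [ha', hk', sub_add_cancel]
    · change C ⟨_, d2⟩ + B ⟨_, d3⟩ = h.snd
      rw [hc', hb', eq_add_of_sub_eq h2, map_sub]
      abel

lemma mem_L0_graph (hA : IsSelfAdjoint A) (hR : IsResolventAt A 0 R) (hAC : A.domain ≤ C.domain)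
    (hG : ∀ g h, (R g, h) ∈ C.graph ↔ h = G g) {f h : WithLp 2 (H × H)} :
    (f, h) ∈ (L0 A B C).graph ↔ (f.fst + adjoint G f.snd, Complex.I • h.snd) ∈ A.graph ∧
      (f.snd, -Complex.I • h.fst - Complex.I • G h.snd) ∈ (S0 A B C).graph := by
  rw [L0, mem_compPMap_graph J_J J_J, mem_A0_graph hA hR hAC hG, J_fst, J_snd, map_smul]

/-- A linear homeomorphism carries the graph of `𝓛₀` onto the product of the graphs of `A` and `S₀`.
Closing a product closes its factors, and `A` is already closed. -/
lemma mem_L_graph (hA : IsSelfAdjoint A) (hR : IsResolventAt A 0 R) (hAC : A.domain ≤ C.domain)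
    (hG : ∀ g h, (R g, h) ∈ C.graph ↔ h = G g) (hS : (S0 A B C).IsClosable)
    {f h : WithLp 2 (H × H)} :
    (f, h) ∈ (L A B C).graph ↔ (f.fst + adjoint G f.snd, Complex.I • h.snd) ∈ A.graph ∧
      (f.snd, -Complex.I • h.fst - Complex.I • G h.snd) ∈ (S0 A B C).closure.graph := by
  have hI : Complex.I * Complex.I = -1 := Complex.I_mul_I
  have hfst : Continuous fun f : WithLp 2 (H × H) => f.fst :=
    (ContinuousLinearMap.fst ℂ H H ∘L
      (WithLp.prodContinuousLinearEquiv 2 ℂ H H).toContinuousLinearMap).continuous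
  have hsnd : Continuous fun f : WithLp 2 (H × H) => f.snd :=
    (ContinuousLinearMap.snd ℂ H H ∘L
      (WithLp.prodContinuousLinearEquiv 2 ℂ H H).toContinuousLinearMap).continuous
  have htoLp : Continuous fun f : H × H => WithLp.toLp 2 f :=
    (WithLp.prodContinuousLinearEquiv 2 ℂ H H).symm.continuous
  let e : WithLp 2 (H × H) × WithLp 2 (H × H) ≃ₜ (H × H) × (H × H) :=
    { toFun := fun p => ((p.1.fst + adjoint G p.1.snd, Complex.I • p.2.snd),
        (p.1.snd, -Complex.I • p.2.fst - Complex.I • G p.2.snd))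
      invFun := fun q => (WithLp.toLp 2 (q.1.1 - adjoint G q.2.1, q.2.1),
        WithLp.toLp 2 (Complex.I • (q.2.2 + G q.1.2), -Complex.I • q.1.2))
      left_inv := fun p => by
        refine Prod.ext ?_ ?_ <;> refine (WithLp.ofLp_injective 2) (Prod.ext ?_ ?_) <;>
          simp [smul_smul, hI]
      right_inv := fun q => by
        refine Prod.ext ?_ ?_ <;> refine Prod.ext ?_ ?_ <;> simp [smul_smul, hI]
      continuous_toFun := by
        have := hfst.comp (continuous_fst (X := WithLp 2 (H × H)) (Y := WithLp 2 (H × H)))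
        have := hsnd.comp (continuous_fst (X := WithLp 2 (H × H)) (Y := WithLp 2 (H × H)))
        have := hfst.comp (continuous_snd (X := WithLp 2 (H × H)) (Y := WithLp 2 (H × H)))
        have := hsnd.comp (continuous_snd (X := WithLp 2 (H × H)) (Y := WithLp 2 (H × H)))
        fun_prop
      continuous_invFun := by
        refine (htoLp.comp ?_).prodMk (htoLp.comp ?_) <;> fun_prop }
  have hgraph : ((L0 A B C).graph : Set _) =
      e ⁻¹' ((A.graph : Set (H × H)) ×ˢ ((S0 A B C).graph : Set (H × H))) := by
    ext ⟨f, h⟩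
    exact mem_L0_graph hA hR hAC hG
  have hcl : ((L0 A B C).graph.topologicalClosure : Set _) =
      e ⁻¹' ((A.graph : Set (H × H)) ×ˢ ((S0 A B C).closure.graph : Set (H × H))) := by
    rw [Submodule.topologicalClosure_coe, hgraph, ← e.preimage_closure, closure_prod_eq,
      hA.isClosed.closure_eq, ← hS.graph_closure_eq_closure_graph, Submodule.topologicalClosure_coe]
  have hfun : ∀ x ∈ (L0 A B C).graph.topologicalClosure, x.1 = 0 → x.2 = 0 := by
    rintro ⟨f, h⟩ hx rfl
    have hx' := SetLike.mem_coe.2 hx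
    rw [hcl] at hx'
    obtain ⟨h1, h2⟩ := hx'
    have h1' : ((0 : H) + adjoint G 0, Complex.I • h.snd) ∈ A.graph := h1
    have h2' : ((0 : H), -Complex.I • h.fst - Complex.I • G h.snd) ∈ (S0 A B C).closure.graph := h2
    rw [map_zero, add_zero] at h1'
    have h3 : h.snd = 0 := by simpa using graph_zero_right h1'
    have h4 := graph_zero_right h2'
    rw [h3] at h4
    have h5 : h.fst = 0 := by simpa using h4
    exact (WithLp.ofLp_injective 2) (Prod.ext h5 h3)
  have hgr := Submodule.toLinearPMap_graph_eq _ hfun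
  have hL0 : (L0 A B C).IsClosable := ⟨_, hgr.symm⟩
  rw [L, ← hL0.graph_closure_eq_closure_graph, ← SetLike.mem_coe, hcl]
  rfl

end Schur

/-! ### Resolvent set, `J`-self-adjointness and definitizing polynomial of the block operator. -/

section BlockOperator

variable {H : Type*} [NormedAddCommGroup H] [InnerProductSpace ℂ H] [CompleteSpace H]
  {A B C : H →ₗ.[ℂ] H} {R G : H →L[ℂ] H}

open ContinuousLinearMap (adjoint)

lemma inner_graph_symm {T : H →ₗ.[ℂ] H} (hT : IsSelfAdjoint T) {x y u v : H}
    (hx : (x, u) ∈ T.graph) (hy : (y, v) ∈ T.graph) : inner ℂ u y = inner ℂ x v := by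
  obtain ⟨f, rfl, rfl⟩ := (LinearPMap.mem_graph_iff _).1 hx
  obtain ⟨g, rfl, rfl⟩ := (LinearPMap.mem_graph_iff _).1 hy
  exact inner_apply_symm hT f g

/-- The form of the closed block operator is the sum of the forms of `A` and of the Schur
complement. -/
lemma inner_J_graph (G : H →L[ℂ] H) (g h : WithLp 2 (H × H)) :
    inner ℂ (J H h) g = inner ℂ (Complex.I • h.snd) (g.fst + adjoint G g.snd) +
      inner ℂ (-Complex.I • h.fst - Complex.I • G h.snd) g.snd := by
  rw [WithLp.prod_inner_apply, inner_add_right, ContinuousLinearMap.adjoint_inner_right,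
    inner_sub_left, map_smul]
  change inner ℂ (Complex.I • h.snd) g.fst + inner ℂ (-Complex.I • h.fst) g.snd = _
  simp
  ring

lemma mem_rho_L_iff (hA : IsSelfAdjoint A) (hR : IsResolventAt A 0 R) (hAC : A.domain ≤ C.domain)
    (hG : ∀ g h, (R g, h) ∈ C.graph ↔ h = G g) (hS : (S0 A B C).IsClosable) {z : ℂ} :
    z ∈ rho (L A B C) ↔ (0 : ℂ) ∈ rho (T A B C z).closure := by
  have hI : Complex.I * Complex.I = -1 := Complex.I_mul_I
  -- With `g = h - z f`, the first component of `f` is explicit in `g` and `f.snd`, and substituting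
  -- it turns `S̄₀` into the closure of `T(z)`.
  have key : ∀ f h : WithLp 2 (H × H), (f, h) ∈ (L A B C).graph ↔
      f.fst = Complex.I • R (h - z • f).snd + (Complex.I * z) • R f.snd - adjoint G f.snd ∧
      (f.snd, -Complex.I • (h - z • f).fst + z • R (h - z • f).snd - Complex.I • G (h - z • f).snd)
        ∈ (T A B C z).closure.graph := by
    intro f h
    rw [mem_L_graph hA hR hAC hG hS, mem_T_closure_graph hA hR hAC hG hS,
      mem_graph_iff_resolvent hR]
    have e1 : (h - z • f).fst = h.fst - z • f.fst := rfl
    have e2 : (h - z • f).snd = h.snd - z • f.snd := rfl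
    rw [e1, e2]
    have h1 : R (Complex.I • h.snd) = f.fst + adjoint G f.snd ↔ f.fst =
        Complex.I • R (h.snd - z • f.snd) + (Complex.I * z) • R f.snd - adjoint G f.snd := by
      rw [eq_sub_iff_add_eq, eq_comm, map_sub, map_smul, map_smul, smul_sub, smul_smul,
        sub_add_cancel]
    rw [h1]
    refine and_congr_right fun h2 => ?_
    have h3 : -Complex.I • h.fst - Complex.I • G h.snd =
        -Complex.I • (h.fst - z • f.fst) + z • R (h.snd - z • f.snd) -
          Complex.I • G (h.snd - z • f.snd) - schurPerturbation R G z f.snd := by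
      have hM : schurPerturbation R G z f.snd = (Complex.I * z) • G f.snd -
        (Complex.I * z) • adjoint G f.snd - (z * z) • R f.snd := rfl
      rw [hM, h2]
      simp only [map_sub, map_smul]
      match_scalars <;> first | ring1 | linear_combination (-z) * hI
    rw [h3]
  constructor
  · rintro ⟨Q, hQ⟩
    rw [isResolventAt_iff] at hQ
    -- The right-hand side `(i k, 0)` is chosen so that the reduced equation in `key` becomes `T̄(z)
    -- f₂ = -i (i k) = k`.
    let P : H →L[ℂ] H := ContinuousLinearMap.snd ℂ H H ∘L
      (WithLp.prodContinuousLinearEquiv 2 ℂ H H).toContinuousLinearMap ∘L Q ∘L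
      (WithLp.prodContinuousLinearEquiv 2 ℂ H H).symm.toContinuousLinearMap ∘L
      (ContinuousLinearMap.inl ℂ H H) ∘L (Complex.I • ContinuousLinearMap.id ℂ H)
    have hP : ∀ k, P k = (Q (WithLp.toLp 2 (Complex.I • k, 0))).snd := fun k => rfl
    refine ⟨P, isResolventAt_iff.2 fun f k => ?_⟩
    rw [zero_smul, sub_zero, hP]
    have hg : ∀ f' : WithLp 2 (H × H), Q (WithLp.toLp 2 (Complex.I • k, 0)) = f' ↔
        f'.fst = (Complex.I * z) • R f'.snd - adjoint G f'.snd ∧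
          (f'.snd, k) ∈ (T A B C z).closure.graph := by
      intro f'
      have := hQ f' (WithLp.toLp 2 (Complex.I • k, 0) + z • f')
      rw [key, add_sub_cancel_right] at this
      rw [← this]
      simp [smul_smul, hI]
    constructor
    · intro hf
      rw [(hg (WithLp.toLp 2 ((Complex.I * z) • R f - adjoint G f, f))).2 ⟨rfl, hf⟩,
        WithLp.toLp_snd]
    · rintro rfl
      exact ((hg _).1 rfl).2
  · rintro ⟨Q, hQ⟩
    rw [isResolventAt_iff] at hQ
    simp only [zero_smul, sub_zero] at hQ
    let E := (WithLp.prodContinuousLinearEquiv 2 ℂ H H).toContinuousLinearMap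
    let p₁ : WithLp 2 (H × H) →L[ℂ] H := ContinuousLinearMap.fst ℂ H H ∘L E
    let p₂ : WithLp 2 (H × H) →L[ℂ] H := ContinuousLinearMap.snd ℂ H H ∘L E
    let P₂ : WithLp 2 (H × H) →L[ℂ] H :=
      Q ∘L (-Complex.I • p₁ + z • (R ∘L p₂) - Complex.I • (G ∘L p₂))
    let P₁ : WithLp 2 (H × H) →L[ℂ] H :=
      Complex.I • (R ∘L p₂) + (Complex.I * z) • (R ∘L P₂) - adjoint G ∘L P₂
    refine ⟨(WithLp.prodContinuousLinearEquiv 2 ℂ H H).symm.toContinuousLinearMap ∘L P₁.prod P₂,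
      isResolventAt_iff.2 fun f h => ?_⟩
    rw [key, hQ]
    set g := h - z • f
    have hval : ((WithLp.prodContinuousLinearEquiv 2 ℂ H H).symm.toContinuousLinearMap ∘L
        P₁.prod P₂) g = WithLp.toLp 2 (P₁ g, P₂ g) := rfl
    have hP₂ : P₂ g = Q (-Complex.I • g.fst + z • R g.snd - Complex.I • G g.snd) := rfl
    have hP₁ : P₁ g = Complex.I • R g.snd + (Complex.I * z) • R (P₂ g) - adjoint G (P₂ g) := rfl
    rw [hval, ← hP₂]
    constructor
    · rintro ⟨h1, h2⟩
      refine (WithLp.ofLp_injective 2) (Prod.ext ?_ h2)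
      rw [← h2] at h1
      exact hP₁.trans h1.symm
    · rintro h1
      have h2 : P₁ g = f.fst := congrArg (fun f : WithLp 2 (H × H) => f.fst) h1
      have h3 : P₂ g = f.snd := congrArg (fun f : WithLp 2 (H × H) => f.snd) h1
      exact ⟨by rw [← h3, ← h2, hP₁], h3⟩

lemma dense_L_domain (hA : IsSelfAdjoint A) (hR : IsResolventAt A 0 R)
    (hAC : A.domain ≤ C.domain) (hG : ∀ g h, (R g, h) ∈ C.graph ↔ h = G g)
    (hS : IsEssentiallySelfAdjoint (S0 A B C)) :
    Dense ((L A B C).domain : Set (WithLp 2 (H × H))) := by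
  have hI : Complex.I * Complex.I = -1 := Complex.I_mul_I
  have hmem : ∀ u a q s, (u, a) ∈ A.graph → (q, s) ∈ (S0 A B C).closure.graph →
      WithLp.toLp 2 (u - adjoint G q, q) ∈ (L A B C).domain := by
    intro u a q s hu hq
    refine LinearPMap.mem_domain_of_mem_graph
      (y := WithLp.toLp 2 (Complex.I • (s + G a), -Complex.I • a)) ?_
    rw [mem_L_graph hA hR hAC hG hS.1]
    simpa [smul_smul, hI] using And.intro hu hq
  rw [Submodule.dense_iff_topologicalClosure_eq_top, Submodule.topologicalClosure_eq_top_iff,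
    Submodule.eq_bot_iff]
  intro y hy
  rw [Submodule.mem_orthogonal] at hy
  have hin : ∀ u a q s, (u, a) ∈ A.graph → (q, s) ∈ (S0 A B C).closure.graph →
      inner ℂ (u - adjoint G q) y.fst + inner ℂ q y.snd = 0 := by
    intro u a q s hu hq
    have := hy _ (hmem u a q s hu hq)
    rwa [WithLp.prod_inner_apply] at this
  have h1 : y.fst = 0 := hA.dense_domain.eq_zero_of_inner_right (𝕜 := ℂ) fun u hu => by
    simpa using hin u _ 0 0 (A.mem_graph ⟨u, hu⟩) (Submodule.zero_mem _)
  have h2 : y.snd = 0 := hS.2.dense_domain.eq_zero_of_inner_right (𝕜 := ℂ) fun q hq => by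
    simpa [h1] using hin 0 0 q _ (Submodule.zero_mem _) ((S0 A B C).closure.mem_graph ⟨q, hq⟩)
  exact (WithLp.ofLp_injective 2) (Prod.ext h1 h2)

lemma inner_J_L_symm (hA : IsSelfAdjoint A) (hR : IsResolventAt A 0 R)
    (hAC : A.domain ≤ C.domain) (hG : ∀ g h, (R g, h) ∈ C.graph ↔ h = G g)
    (hS : IsEssentiallySelfAdjoint (S0 A B C)) (x y : (L A B C).domain) :
    inner ℂ (J H (L A B C x)) (y : WithLp 2 (H × H)) =
      inner ℂ (x : WithLp 2 (H × H)) (J H (L A B C y)) := by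
  obtain ⟨hx1, hx2⟩ := (mem_L_graph hA hR hAC hG hS.1).1 ((L A B C).mem_graph x)
  obtain ⟨hy1, hy2⟩ := (mem_L_graph hA hR hAC hG hS.1).1 ((L A B C).mem_graph y)
  rw [inner_J_graph G, ← inner_conj_symm (x : WithLp 2 (H × H)),
    inner_J_graph G, map_add, inner_conj_symm, inner_conj_symm,
    inner_graph_symm hA hx1 hy1, inner_graph_symm hS.2 hx2 hy2]

lemma isJSelfAdjoint_L (hA : IsSelfAdjoint A) (hR : IsResolventAt A 0 R)
    (hAC : A.domain ≤ C.domain) (hG : ∀ g h, (R g, h) ∈ C.graph ↔ h = G g)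
    (hS : IsEssentiallySelfAdjoint (S0 A B C)) : IsJSelfAdjoint (J H) (L A B C) := by
  have hI : Complex.I * Complex.I = -1 := Complex.I_mul_I
  refine isSelfAdjoint_of_maximal (dense_L_domain hA hR hAC hG hS)
    (inner_J_L_symm hA hR hAC hG hS) fun x y hxy => ?_
  have hin : ∀ f h, (f, h) ∈ (L A B C).graph → inner ℂ y f = inner ℂ x (J H h) := by
    intro f h hf
    obtain ⟨w, rfl, rfl⟩ := (LinearPMap.mem_graph_iff _).1 hf
    exact hxy w
  -- The pairs from the two graphs can be chosen independently; setting one of them to zero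
  -- separates the adjoint relation into one for `A` and one for `S̄₀`.
  have hin2 : ∀ u a q s, (u, a) ∈ A.graph → (q, s) ∈ (S0 A B C).closure.graph →
      inner ℂ y.fst (u - adjoint G q) + inner ℂ y.snd q =
        inner ℂ x.fst a + inner ℂ x.snd (s + G a) := by
    intro u a q s hu hq
    have := hin (WithLp.toLp 2 (u - adjoint G q, q))
      (WithLp.toLp 2 (Complex.I • (s + G a), -Complex.I • a)) (by
        rw [mem_L_graph hA hR hAC hG hS.1]
        simpa [smul_smul, hI] using And.intro hu hq)
    rw [WithLp.prod_inner_apply, WithLp.prod_inner_apply] at this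
    change inner ℂ y.fst (u - adjoint G q) + inner ℂ y.snd q =
      inner ℂ x.fst (Complex.I • (-Complex.I • a)) +
        inner ℂ x.snd (-Complex.I • (Complex.I • (s + G a))) at this
    simpa only [smul_smul, mul_neg, neg_mul, hI, neg_neg, one_smul] using this
  rw [mem_compPMap_graph J_J J_J, mem_L_graph hA hR hAC hG hS.1, J_fst, J_snd]
  constructor
  · have : (x.fst + adjoint G x.snd, y.fst) ∈ A.graph := mem_graph_of_forall_inner hA fun u => by
      have := hin2 u _ 0 0 (A.mem_graph u) (Submodule.zero_mem _)
      simpa [inner_add_left, ContinuousLinearMap.adjoint_inner_left] using this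
    simpa [smul_smul, hI] using this
  · have : (x.snd, y.snd - G y.fst) ∈ (S0 A B C).closure.graph :=
      mem_graph_of_forall_inner hS.2 fun q => by
        have := hin2 0 0 q _ (Submodule.zero_mem _) ((S0 A B C).closure.mem_graph q)
        simp only [zero_sub, inner_neg_right, ContinuousLinearMap.adjoint_inner_right,
          inner_zero_right, map_zero, add_zero, zero_add] at this
        rw [inner_sub_left, ← this]
        ring
    simpa [smul_smul, hI] using this

/-- The closed block operator has a definitizing polynomial. -/
lemma exists_definitizing_polynomial_L (hA : IsSelfAdjoint A) (hR : IsResolventAt A 0 R)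
    (hAneg : kappaMinus A < Cardinal.aleph0)
    (hAC : A.domain ≤ C.domain) (hG : ∀ g h, (R g, h) ∈ C.graph ↔ h = G g)
    (hS : IsEssentiallySelfAdjoint (S0 A B C))
    (hSneg : kappaMinus (S0 A B C).closure < Cardinal.aleph0) :
    ∃ p : Polynomial ℝ, p ≠ 0 ∧ ∀ f : (polyOp p (L A B C)).domain,
      0 ≤ inner ℂ (J H (polyOp p (L A B C) f)) (f : WithLp 2 (H × H)) := by
  have := finiteDimensional_of_kappaMinus hAneg
  have := finiteDimensional_of_kappaMinus hSneg
  let N₁ := ranSpectralProj A (Set.Iio 0)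
  let N₂ := ranSpectralProj (S0 A B C).closure (Set.Iio 0)
  let E := (WithLp.linearEquiv 2 ℂ (H × H)).toLinearMap
  let p₁ : WithLp 2 (H × H) →ₗ[ℂ] H := LinearMap.fst ℂ H H ∘ₗ E
  let p₂ : WithLp 2 (H × H) →ₗ[ℂ] H := LinearMap.snd ℂ H H ∘ₗ E
  -- On the kernel of `g` the vectors fed to `A` and `S̄₀` are orthogonal to the respective negative
  -- spectral subspaces, so both summands of the form are nonnegative.
  let g : (L A B C).domain →ₗ[ℂ] N₁ × N₂ :=
    ((N₁.orthogonalProjectionOnto.toLinearMap ∘ₗ (p₁ + (adjoint G).toLinearMap ∘ₗ p₂)).prod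
      (N₂.orthogonalProjectionOnto.toLinearMap ∘ₗ p₂)) ∘ₗ (L A B C).domain.subtype
  refine exists_definitizing_polynomial inner_J
    (fun x hx => by rw [← J_J x, hx, map_zero]) (inner_J_L_symm hA hR hAC hG hS)
    (dense_L_domain hA hR hAC hG hS) g fun x hx => ?_
  obtain ⟨hx1, hx2⟩ := (mem_L_graph hA hR hAC hG hS.1).1 ((L A B C).mem_graph x)
  obtain ⟨hg1, hg2⟩ := Prod.ext_iff.1 hx
  have hg1' : N₁.orthogonalProjectionOnto ((x : WithLp 2 (H × H)).fst +
    adjoint G (x : WithLp 2 (H × H)).snd) = 0 := hg1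
  have hg2' : N₂.orthogonalProjectionOnto (x : WithLp 2 (H × H)).snd = 0 := hg2
  rw [Submodule.orthogonalProjectionOnto_eq_zero_iff, Submodule.mem_orthogonal] at hg1' hg2'
  rw [inner_J_graph G, Complex.add_re]
  obtain ⟨u, hu, hu'⟩ := (LinearPMap.mem_graph_iff _).1 hx1
  obtain ⟨q, hq, hq'⟩ := (LinearPMap.mem_graph_iff _).1 hx2
  dsimp only at hu hu' hq hq'
  rw [← hu] at hg1' ⊢
  rw [← hq] at hg2' ⊢
  rw [← hu', ← hq']
  exact add_nonneg (re_inner_nonneg_of_orthogonal hA u hg1')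
    (re_inner_nonneg_of_orthogonal hS.2 q hg2')

end BlockOperator

end BlockOp

theorem corollary3p2 {H : Type*} [NormedAddCommGroup H] [InnerProductSpace ℂ H] [CompleteSpace H]
    [TopologicalSpace.SeparableSpace H] (A B C : H →ₗ.[ℂ] H)
    (hA : IsSelfAdjoint A) (hA0 : (0 : ℂ) ∈ BlockOp.rho A)
    (hAneg : BlockOp.kappaMinus A < Cardinal.aleph0)
    (hC : C.IsClosed) (hAC : A.domain ≤ C.domain) (hAC' : A.domain ≤ (C†).domain)
    (hB : IsSelfAdjoint B)
    (hS0dom : Dense ((BlockOp.S0 A B C).domain : Set H))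
    (hS0 : BlockOp.IsEssentiallySelfAdjoint (BlockOp.S0 A B C))
    (hS0neg : BlockOp.kappaMinus (BlockOp.S0 A B C).closure < Cardinal.aleph0) :
    BlockOp.IsDefinitizable (BlockOp.J H) (BlockOp.L A B C) ↔
      ∃ z : ℂ, (0 : ℂ) ∈ BlockOp.rho (BlockOp.T A B C z).closure := by
  obtain ⟨R, hR⟩ := hA0
  obtain ⟨G, hG⟩ := BlockOp.exists_mul_resolvent hR hC hAC
  constructor
  · rintro ⟨_, ⟨z, hz⟩, _⟩
    exact ⟨z, (BlockOp.mem_rho_L_iff hA hR hAC hG hS0.1).1 hz⟩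
  · rintro ⟨z, hz⟩
    exact ⟨BlockOp.isJSelfAdjoint_L hA hR hAC hG hS0,
      ⟨z, (BlockOp.mem_rho_L_iff hA hR hAC hG hS0.1).2 hz⟩,
      BlockOp.exists_definitizing_polynomial_L hA hR hAneg hAC hG hS0 hS0neg⟩
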